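/- Let $E$ be a Polish space with its Borel $\sigma$-field and let $\mathscr H$ be a separable reproducing kernel Hilbert space of real functions on $E$ with kernel $k$, whose canonical feature map $\varphi(x)=k(x,\cdot)$, $\varphi\colon E\to\mathscr H$, is Borel measurable. Let $S_2(\mathscr H)$ be the Hilbert space of Hilbert–Schmidt operators on $\mathscr H$, and for elements $u,v$ of a Hilbert space write $u\otimes v$ for the rank-one operator $x\mapsto\langle x,v\rangle u$. Let $(X_t)_{t\in\mathbb Z}$ be an $E$-valued stochastic process on a probability space $(\Omega,\mathcal F,\mathbb P)$ that is stationary (all finite-dimensional laws are invariant under time shifts) and $\alpha$-mixing, i.e. $\alpha(n)\to0$ as $n\to\infty$, where $$\alpha(n):=\sup\{|\mathbb P[A\cap B]-\mathbb P[A]\,\mathbb P[B]| : A\in\sigma(X_t,\,t\le 0),\ B\in\sigma(X_t,\,t\ge n)\}.$$ Assume that $\sup_{x\in E}k(x,x)=c<\infty$ and that $\mathbb E[\varphi(X_0)]=0$. Fix a time lag $\eta\in\{0,1,2,\dots\}$ and put $$C(\eta):=\mathbb E\big[(\varphi(X_\eta)-\mathbb E\varphi(X_\eta))\otimes(\varphi(X_0)-\mathbb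 E\varphi(X_0))\big]=\mathbb E[\varphi(X_\eta)\otimes\varphi(X_0)],\qquad C_n(\eta):=\frac1n\sum_{t=1}^n\varphi(X_{t+\eta})\otimes\varphi(X_t).$$ Let $\lambda_1\ge\lambda_2\ge\dots\ge0$ be the eigenvalues, ordered nonincreasingly and repeated according to multiplicity (and continued by zeros if there are only finitely many positive ones), of the covariance operator $\Gamma\colon S_2(\mathscr H)\to S_2(\mathscr H)$, $$\Gamma:=\mathbb E\Big[\big(\varphi(X_\eta)\otimes\varphi(X_0)-C(\eta)\big)\otimes\big(\varphi(X_\eta)\otimes\varphi(X_0)-C(\eta)\big)\Big].$$ Then $\sum_j\lambda_j<\infty$, and for every $\epsilon>0$, every integer $\nu\ge1$, every integer $n\ge2$, every $q\in\{1,\dots,\lfloor n/2\rfloor\}$ and every $\delta\in(0,1)$, $$\mathbb P\big[\|C_n(\eta)-C(\eta)\|_{S_2(\mathscr H)}>\epsilon\big]\le 4\nu\exp\Big(-\frac{(1-\delta)\epsilon^2q}{32\nu c^2}\Big)+22\nu q\Big(1+\frac{8c}{\epsilon(1-\delta)^{1/2}}\Big)^{1/2}\alpha\Big(\Big\lfloor\frac{n}{2q}\Big\rfloor\Big)+\frac1{\delta\epsilon^2}\sum_{j>\nu}\lambda_j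 .$$ (In the trivial case $c=0$, where the left side is $0$, the first term on the right is read as $4\nu$.) -/

import Mathlib

open MeasureTheory Filter Topology
open scoped ENNReal

noncomputable section

section HilbertSchmidt

variable (H : Type*) [NormedAddCommGroup H] [InnerProductSpace ℝ H] [CompleteSpace H]

/-- The index set of a fixed complete orthonormal system of `H`. -/
def HSIndex : Set H := (exists_hilbertBasis ℝ H).choose

/-- A fixed complete orthonormal system of `H`. -/
def hsBasis : HilbertBasis (HSIndex H) ℝ H := (exists_hilbertBasis ℝ H).choose_spec.choose

/-- The bounded operators `A` on `H` with `∑ i, ‖A e i‖ ^ 2 < ∞`. -/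
def hsSubmodule : Submodule ℝ (H →L[ℝ] H) where
  carrier := {A | Memℓp (fun i : HSIndex H => A (hsBasis H i)) 2}
  zero_mem' := by
    show Memℓp (fun i : HSIndex H => (0 : H →L[ℝ] H) (hsBasis H i)) 2
    exact (zero_memℓp : Memℓp (0 : HSIndex H → H) 2)
  add_mem' := fun ha hb => Memℓp.add ha hb
  smul_mem' := fun c _ ha => Memℓp.const_smul ha c

/-- The space `S₂(H)` of Hilbert–Schmidt operators on `H`. It is a type of its own because its norm
is the Hilbert–Schmidt norm and not the operator norm. -/
def HSOp : Type _ := hsSubmodule H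

instance : AddCommGroup (HSOp H) := inferInstanceAs (AddCommGroup (hsSubmodule H))

instance : Module ℝ (HSOp H) := inferInstanceAs (Module ℝ (hsSubmodule H))

variable {H}

/-- The underlying bounded operator of a Hilbert–Schmidt operator. -/
def HSOp.toCLM (A : HSOp H) : H →L[ℝ] H := Subtype.val A

variable (H)

/-- The family `(A e i)` of a Hilbert–Schmidt operator `A`, as a square-summable family. -/
def HSOp.toLp : HSOp H →ₗ[ℝ] lp (fun _ : HSIndex H => H) 2 where
  toFun A := ⟨fun i => A.toCLM (hsBasis H i), A.2⟩
  map_add' _ _ := rfl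
  map_smul' _ _ := rfl

theorem HSOp.toLp_injective : Function.Injective (HSOp.toLp H) := by
  intro A B h
  apply Subtype.ext
  have h' : ∀ i, A.toCLM (hsBasis H i) = B.toCLM (hsBasis H i) := fun i =>
    congrFun (congrArg Subtype.val h) i
  refine ContinuousLinearMap.ext_on (s := Set.range (hsBasis H)) ?_ ?_
  · exact Submodule.dense_iff_topologicalClosure_eq_top.mpr (hsBasis H).dense_span
  · rintro _ ⟨i, rfl⟩
    exact h' i

/-- The Hilbert–Schmidt norm, `‖A‖ ^ 2 = ∑ i, ‖A e i‖ ^ 2`. -/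
instance : NormedAddCommGroup (HSOp H) :=
  NormedAddCommGroup.induced (HSOp H) (lp (fun _ : HSIndex H => H) 2) (HSOp.toLp H)
    (HSOp.toLp_injective H)

/-- The Hilbert–Schmidt inner product, `⟪A, B⟫ = ∑ i, ⟪A e i, B e i⟫ = tr (A* B)`. -/
instance : InnerProductSpace ℝ (HSOp H) where
  toNormedSpace := NormedSpace.induced ℝ (HSOp H) (lp (fun _ : HSIndex H => H) 2) (HSOp.toLp H)
  inner A B := inner ℝ (HSOp.toLp H A) (HSOp.toLp H B)
  norm_sq_eq_re_inner A := norm_sq_eq_re_inner (𝕜 := ℝ) (HSOp.toLp H A)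
  conj_inner_symm A B := inner_conj_symm (HSOp.toLp H A) (HSOp.toLp H B)
  add_left A B C := by rw [map_add, inner_add_left]
  smul_left A B r := by rw [map_smul, inner_smul_left]

theorem HSOp.summable_coord (f : lp (fun _ : HSIndex H => H) 2) (x : H) :
    Summable (fun i => ‖(hsBasis H).repr x i‖ * ‖f i‖) := by
  have h1 := lp.hasSum_norm (p := 2) (by norm_num) ((hsBasis H).repr x)
  have h2 := lp.hasSum_norm (p := 2) (by norm_num) f
  exact (Real.summable_and_inner_le_Lp_mul_Lq_tsum_of_nonneg Real.HolderConjugate.two_two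
    (fun i => norm_nonneg _) (fun i => norm_nonneg _)
    (by simpa using h1.summable) (by simpa using h2.summable)).1

theorem HSOp.toLp_surjective : Function.Surjective (HSOp.toLp H) := by
  intro f
  have hs : ∀ x : H, Summable (fun i => (hsBasis H).repr x i • f i) := fun x =>
    Summable.of_norm (by simpa [norm_smul] using HSOp.summable_coord H f x)
  let L : H →ₗ[ℝ] H :=
    { toFun := fun x => ∑' i, (hsBasis H).repr x i • f i
      map_add' := fun x y => by
        simp only [map_add, lp.coeFn_add, Pi.add_apply, add_smul]
        exact (hs x).tsum_add (hs y)
      map_smul' := fun r x => by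
        simp only [map_smul, lp.coeFn_smul, Pi.smul_apply, smul_assoc, RingHom.id_apply]
        exact (hs x).tsum_const_smul r }
  have hL : ∀ x, ‖L x‖ ≤ ‖f‖ * ‖x‖ := by
    intro x
    have h1 := lp.hasSum_norm (p := 2) (by norm_num) ((hsBasis H).repr x)
    have h2 := lp.hasSum_norm (p := 2) (by norm_num) f
    have h3 := (Real.summable_and_inner_le_Lp_mul_Lq_tsum_of_nonneg Real.HolderConjugate.two_two
      (fun i => norm_nonneg ((hsBasis H).repr x i)) (fun i => norm_nonneg (f i))
      (by simpa using h1.summable) (by simpa using h2.summable)).2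
    have e1 := lp.norm_eq_tsum_rpow (p := 2) (by norm_num) ((hsBasis H).repr x)
    have e2 := lp.norm_eq_tsum_rpow (p := 2) (by norm_num) f
    simp only [ENNReal.toReal_ofNat] at e1 e2
    rw [← e1, ← e2, LinearIsometryEquiv.norm_map] at h3
    calc ‖L x‖ ≤ ∑' i, ‖(hsBasis H).repr x i • f i‖ :=
          norm_tsum_le_tsum_norm (by simpa [norm_smul] using HSOp.summable_coord H f x)
      _ = ∑' i, ‖(hsBasis H).repr x i‖ * ‖f i‖ := by simp only [norm_smul]
      _ ≤ ‖f‖ * ‖x‖ := by rw [mul_comm]; exact h3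
  have hb : ∀ i, L (hsBasis H i) = f i := by
    classical
    intro i
    show ∑' j, (hsBasis H).repr (hsBasis H i) j • f j = f i
    rw [tsum_eq_single i]
    · rw [HilbertBasis.repr_self, lp.single_apply_self, one_smul]
    · intro j hj
      rw [HilbertBasis.repr_self, lp.single_apply_ne _ _ _ hj, zero_smul]
  have hm : L.mkContinuous ‖f‖ hL ∈ hsSubmodule H := by
    show Memℓp (fun i : HSIndex H => L (hsBasis H i)) 2
    simp only [hb]
    exact f.2
  exact ⟨⟨L.mkContinuous ‖f‖ hL, hm⟩, Subtype.ext (funext hb)⟩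

instance : CompleteSpace (HSOp H) := by
  have hi : Isometry (HSOp.toLp H) :=
    AddMonoidHomClass.isometry_of_norm (HSOp.toLp H) (fun _ => rfl)
  rw [hi.isUniformInducing.completeSpace_congr (HSOp.toLp_surjective H)]
  infer_instance

variable {H}

theorem rankOne_mem_hsSubmodule (x y : H) :
    InnerProductSpace.rankOne ℝ x y ∈ hsSubmodule H := by
  show Memℓp (fun i : HSIndex H => InnerProductSpace.rankOne ℝ x y (hsBasis H i)) 2
  refine memℓp_gen ?_
  have h := ((hsBasis H).summable_inner_mul_inner y y).mul_right (‖x‖ ^ 2)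
  refine h.congr fun i => ?_
  simp only [InnerProductSpace.rankOne_apply, norm_smul, ENNReal.toReal_ofNat, Real.rpow_ofNat,
    mul_pow, Real.norm_eq_abs, sq_abs]
  rw [real_inner_comm y (hsBasis H i)]
  ring

/-- The rank-one operator `x ⊗ y : z ↦ ⟪z, y⟫ x`, as a Hilbert–Schmidt operator. -/
def hsTensor (x y : H) : HSOp H :=
  ⟨InnerProductSpace.rankOne ℝ x y, rankOne_mem_hsSubmodule x y⟩

end HilbertSchmidt

section Spectrum

/-- The `(j+1)`-st largest positive eigenvalue, counted with multiplicity, of a compact positive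
operator `T`; it is `0` if `T` has at most `j` positive eigenvalues. That is, the largest `t > 0`
such that the eigenspaces for eigenvalues `≥ t` together have dimension at least `j + 1`. -/
def eigenvalueSeq {F : Type*} [NormedAddCommGroup F] [NormedSpace ℝ F] (T : F →L[ℝ] F)
    (j : ℕ) : ℝ :=
  sSup {t : ℝ | 0 < t ∧ (j : Cardinal) <
    Module.rank ℝ (⨆ s ∈ Set.Ici t, Module.End.eigenspace (T : F →ₗ[ℝ] F) s : Submodule ℝ F)}

end Spectrum

section Mixing

variable {Ω : Type*} [MeasurableSpace Ω] {E : Type*} [MeasurableSpace E]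

/-- All finite-dimensional laws of the process are invariant under time shifts. -/
def IsStationarySeq (μ : Measure Ω) (X : ℤ → Ω → E) : Prop :=
  ∀ (r : ℕ) (t : Fin r → ℤ) (s : ℕ),
    μ.map (fun ω i => X (t i) ω) = μ.map (fun ω i => X (t i + s) ω)

/-- The strong mixing coefficient of two families of events. -/
def alphaCoeff (μ : Measure Ω) (m₁ m₂ : MeasurableSpace Ω) : ℝ :=
  sSup {a : ℝ | ∃ A B : Set Ω, MeasurableSet[m₁] A ∧ MeasurableSet[m₂] B ∧
    a = |μ.real (A ∩ B) - μ.real A * μ.real B|}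

/-- The `σ`-field generated by the `X t` with `t ∈ I`. -/
abbrev sigmaField (X : ℤ → Ω → E) (I : Set ℤ) : MeasurableSpace Ω :=
  ⨆ t ∈ I, MeasurableSpace.comap (X t) inferInstance

/-- The mixing coefficient `α(n)` of the process, between `σ(X t, t ≤ 0)` and `σ(X t, t ≥ n)`. -/
def alphaMix (μ : Measure Ω) (X : ℤ → Ω → E) (n : ℤ) : ℝ :=
  alphaCoeff μ (sigmaField X (Set.Iic 0)) (sigmaField X (Set.Ici n))

def IsAlphaMixing (μ : Measure Ω) (X : ℤ → Ω → E) : Prop :=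
  Tendsto (alphaMix μ X) atTop (𝓝 0)

end Mixing

section Embedding

variable {Ω : Type*} [MeasurableSpace Ω] {E : Type*} (H : Type*) [NormedAddCommGroup H]
  [InnerProductSpace ℝ H] [CompleteSpace H] [RKHS ℝ H E ℝ]

/-- The canonical feature map `φ(x) = k(x, ·)` of the reproducing kernel Hilbert space `H`. -/
def featureMap (x : E) : H := RKHS.kerFun H x 1

/-- The real-valued reproducing kernel `k` of `H`. -/
def rkhsKernel (x y : E) : ℝ := RKHS.kernel H x y 1

/-- The mean embedding `𝔼[φ(Y)]`. -/
def meanEmbedding (μ : Measure Ω) (Y : Ω → E) : H := ∫ ω, featureMap H (Y ω) ∂μ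

/-- The kernel cross-covariance operator `𝔼[(φ(Y) - 𝔼 φ(Y)) ⊗ (φ(Z) - 𝔼 φ(Z))]`. -/
def crossCov (μ : Measure Ω) (Y Z : Ω → E) : HSOp H :=
  ∫ ω, hsTensor (featureMap H (Y ω) - meanEmbedding H μ Y)
    (featureMap H (Z ω) - meanEmbedding H μ Z) ∂μ

/-- The kernel autocovariance operator `C(η)`. -/
def autocov (μ : Measure Ω) (X : ℤ → Ω → E) (η : ℕ) : HSOp H :=
  crossCov H μ (X η) (X 0)

/-- The empirical autocovariance operator `C_n(η) = n⁻¹ ∑_{t=1}^n φ(X_{t+η}) ⊗ φ(X_t)`. -/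
def empAutocov (X : ℤ → Ω → E) (η n : ℕ) (ω : Ω) : HSOp H :=
  (n : ℝ)⁻¹ • ∑ t ∈ Finset.Icc 1 n,
    hsTensor (featureMap H (X ((t : ℤ) + η) ω)) (featureMap H (X (t : ℤ) ω))

/-- The covariance operator `Γ` on `S₂(H)` of the random element `φ(X_η) ⊗ φ(X_0)`. -/
def covOfTensor (μ : Measure Ω) (X : ℤ → Ω → E) (η : ℕ) : HSOp H →L[ℝ] HSOp H :=
  ∫ ω, InnerProductSpace.rankOne ℝ
    (hsTensor (featureMap H (X η ω)) (featureMap H (X 0 ω)) - autocov H μ X η)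
    (hsTensor (featureMap H (X η ω)) (featureMap H (X 0 ω)) - autocov H μ X η) ∂μ

end Embedding

end

/-!
A stronger, dimension-free estimate holds, without the eigenvalue tail, the factors `ν` and the
`1 - δ`: the deviation probability is at most `2 exp (-ε² q / (32 c²)) + 128 (c / ε) α(M)`. Write `Y t = φ(X (t + η)) ⊗ φ(X t)`, let `C = 𝔼 Y t` be the
autocovariance and `M = ⌊n / (2 q)⌋`. For a gap `L` let `ℱ t` be generated by the `X u` with
`u ≤ t - L + η`, and split
`Y t - C = (Y t - 𝔼[Y t | ℱ t]) + (𝔼[Y t | ℱ t] - C)`.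

The first summands form a bounded martingale difference sequence along each residue class modulo
`L`. A martingale inequality of Pinelis type (`integral_cosh_norm_sum_le`) bounds the mean of
`cosh (λ ‖·‖)` for each class. It rests on the pointwise bound `cosh_norm_add_le`, which expresses
that `cosh √s` is convex in `s`. Convexity of `cosh ‖·‖` averages over the classes
(`measureReal_le_norm_average_le`), so that neither a union bound nor a projection onto finitely
many eigenvectors is needed.

The second summands are small in `L¹`. By duality their `L¹` norm is a covariance between bounded
Hilbert-valued functions of the past and of the future. A version of Grothendieck's inequality
(`integral_inner_sub_le_alphaCoeff`) bounds such covariances by `32 α` times the bounds of the two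
functions, in any dimension: embed `ℝ ^ d` isometrically into `L²` of random signs and truncate
there, which costs a multiple of the scalar bound `4 α` and leaves remainders that are smaller by a
constant factor; iterate. The lag enters in `integral_norm_condExp_hsTensor_sub_le`. If `η ≤ M`, the
gap `L = 2 M` separates both factors of `Y t` from the past by `M`. If `η ≥ M`, the gap `L = M`
separates `φ(X (t + η))` from a past that contains `φ(X t)`, and `𝔼 φ(X (t + η)) = 0`; the
covariance is then that of `φ(X (t + η))` with an operator from the past applied to `φ(X t)`. In
both cases `⌊n / L⌋ ≥ q`, and Markov's inequality gives a bias probability of at most `128 (c / ε) α(M)`. This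
is below `22 q α(M)` as soon as the exponential term of the claim is below `1`.

Summability of the eigenvalues of `Γ` follows by choosing orthonormal vectors greedily in the spans
of the leading eigenspaces (`summable_eigenvalueSeq`) and Bessel's inequality.
-/

/-! ### Scalar covariance inequality for strongly mixing σ-fields -/

section AlphaCoeff

open ProbabilityTheory

/-- The `±1`-valued function that is `1` exactly on `A`. -/
noncomputable def signOn {Ω : Type*} (A : Set Ω) (ω : Ω) : ℝ := A.indicator (fun _ => 2) ω - 1

theorem signOn_of_mem {Ω : Type*} {A : Set Ω} {ω : Ω} (h : ω ∈ A) : signOn A ω = 1 := by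
  rw [signOn, Set.indicator_of_mem h]; norm_num

theorem signOn_of_notMem {Ω : Type*} {A : Set Ω} {ω : Ω} (h : ω ∉ A) : signOn A ω = -1 := by
  rw [signOn, Set.indicator_of_notMem h]; norm_num

theorem norm_signOn_le {Ω : Type*} (A : Set Ω) (ω : Ω) : ‖signOn A ω‖ ≤ 1 := by
  by_cases h : ω ∈ A
  · simp [signOn_of_mem h]
  · simp [signOn_of_notMem h]

theorem stronglyMeasurable_signOn {Ω : Type*} {m₁ : MeasurableSpace Ω} {A : Set Ω}
    (hA : MeasurableSet[m₁] A) : StronglyMeasurable[m₁] (signOn A) :=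
  (stronglyMeasurable_const.indicator hA).sub stronglyMeasurable_const

variable {Ω : Type*} {m₁ m₂ : MeasurableSpace Ω} [m0 : MeasurableSpace Ω] {μ : Measure Ω}
  [IsProbabilityMeasure μ]

theorem abs_measureReal_inter_sub_mul_le_one (A B : Set Ω) :
    |μ.real (A ∩ B) - μ.real A * μ.real B| ≤ 1 := by
  have h1 := measureReal_le_one (μ := μ) (s := A ∩ B)
  have h2 := measureReal_le_one (μ := μ) (s := A)
  have h3 := measureReal_le_one (μ := μ) (s := B)
  have h4 : 0 ≤ μ.real (A ∩ B) := measureReal_nonneg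
  have h5 : 0 ≤ μ.real A := measureReal_nonneg
  have h6 : 0 ≤ μ.real B := measureReal_nonneg
  rw [abs_le]
  constructor <;> nlinarith [mul_nonneg h5 h6]

theorem abs_measureReal_inter_sub_mul_le_alphaCoeff {A B : Set Ω}
    (hA : MeasurableSet[m₁] A) (hB : MeasurableSet[m₂] B) :
    |μ.real (A ∩ B) - μ.real A * μ.real B| ≤ alphaCoeff μ m₁ m₂ := by
  refine le_csSup ⟨1, ?_⟩ ⟨A, B, hA, hB, rfl⟩
  rintro _ ⟨A, B, -, -, rfl⟩
  exact abs_measureReal_inter_sub_mul_le_one A B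

theorem alphaCoeff_nonneg : 0 ≤ alphaCoeff μ m₁ m₂ :=
  (abs_nonneg _).trans (abs_measureReal_inter_sub_mul_le_alphaCoeff
    (@MeasurableSet.empty _ m₁) (@MeasurableSet.empty _ m₂))

theorem memLp_of_norm_le {G : Type*} [NormedAddCommGroup G] {f : Ω → G} {a : ℝ} {p : ℝ≥0∞}
    (hm : m₁ ≤ m0) (hf : StronglyMeasurable[m₁] f) (hfa : ∀ ω, ‖f ω‖ ≤ a) : MemLp f p μ :=
  MemLp.of_bound (hf.mono hm).aestronglyMeasurable a (ae_of_all _ hfa)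

theorem covariance_signOn_le (hm₁ : m₁ ≤ m0) (hm₂ : m₂ ≤ m0) {A B : Set Ω}
    (hA : MeasurableSet[m₁] A) (hB : MeasurableSet[m₂] B) :
    cov[signOn A, signOn B; μ] ≤ 4 * alphaCoeff μ m₁ m₂ := by
  have hA' := hm₁ A hA
  have hB' := hm₂ B hB
  have iA : Integrable (A.indicator fun _ : Ω => (2 : ℝ)) μ :=
    (integrable_const _).indicator hA'
  have iB : Integrable (B.indicator fun _ : Ω => (2 : ℝ)) μ :=
    (integrable_const _).indicator hB'
  have h1 : cov[signOn A, signOn B; μ] =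
      cov[A.indicator fun _ => 2, B.indicator fun _ => 2; μ] := by
    unfold signOn
    rw [covariance_sub_const_left iA, covariance_sub_const_right iB]
  have h2 : (A.indicator fun _ : Ω => (2 : ℝ)) * (B.indicator fun _ => 2) =
      (A ∩ B).indicator fun _ => 4 := by
    ext ω
    by_cases ha : ω ∈ A <;> by_cases hb : ω ∈ B <;> simp [ha, hb]; norm_num
  have key := abs_measureReal_inter_sub_mul_le_alphaCoeff (μ := μ) hA hB
  rw [h1, covariance_eq_sub (memLp_indicator_const 2 hA' _ (Or.inr (measure_ne_top _ _)))
    (memLp_indicator_const 2 hB' _ (Or.inr (measure_ne_top _ _))), h2,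
    integral_indicator_const _ (hA'.inter hB'), integral_indicator_const _ hA',
    integral_indicator_const _ hB']
  simp only [smul_eq_mul]
  linarith [le_abs_self (μ.real (A ∩ B) - μ.real A * μ.real B)]

/-- Among the `m₁`-measurable functions with values in `[-1, 1]`, the covariance with a given
function is maximised by a sign, that of the centred conditional expectation. -/
theorem exists_covariance_le_covariance_signOn (hm : m₁ ≤ m0) {f g : Ω → ℝ}
    (hf : StronglyMeasurable[m₁] f) (hf1 : ∀ ω, ‖f ω‖ ≤ 1) (hg : MemLp g 2 μ) :
    ∃ A, MeasurableSet[m₁] A ∧ cov[f, g; μ] ≤ cov[signOn A, g; μ] := by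
  set h : Ω → ℝ := fun ω => g ω - μ[g] with hh
  have gi : Integrable g μ := hg.integrable (by norm_num)
  have hi : Integrable h μ := gi.sub (integrable_const _)
  -- The centring of the first argument is immaterial since `h` has mean zero.
  have hcov : ∀ u : Ω → ℝ, StronglyMeasurable[m₁] u → (∀ ω, ‖u ω‖ ≤ 1) →
      Integrable (u * μ[h | m₁]) μ ∧ cov[u, g; μ] = ∫ ω, u ω * (μ[h | m₁]) ω ∂μ := by
    intro u hu hu1
    have hum := (hu.mono hm).aestronglyMeasurable (μ := μ)
    refine ⟨integrable_condExp.bdd_mul hum (ae_of_all _ hu1), ?_⟩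
    have hui : Integrable (fun ω => u ω * h ω) μ := hi.bdd_mul hum (ae_of_all _ hu1)
    have e1 : cov[u, g; μ] = ∫ ω, u ω * h ω ∂μ := by
      have : ∀ ω, (u ω - μ[u]) * (g ω - μ[g]) = u ω * h ω - μ[u] * h ω := by
        intro ω; simp only [hh]; ring
      rw [covariance]
      simp_rw [this]
      rw [integral_sub hui (hi.const_mul _), integral_const_mul, integral_sub gi
        (integrable_const _)]
      simp
    have e2 := condExp_mul_of_stronglyMeasurable_left hu hui hi
    rw [e1, ← integral_condExp hm]
    exact integral_congr_ae e2
  have hc : StronglyMeasurable[m₁] (μ[h | m₁]) := stronglyMeasurable_condExp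
  let A := {ω | 0 ≤ (μ[h | m₁]) ω}
  have hA : MeasurableSet[m₁] A := hc.measurable measurableSet_Ici
  refine ⟨A, hA, ?_⟩
  obtain ⟨i1, e1⟩ := hcov f hf hf1
  obtain ⟨i2, e2⟩ := hcov _ (stronglyMeasurable_signOn hA) (norm_signOn_le A)
  rw [e1, e2]
  refine integral_mono i1 i2 fun ω => ?_
  have := abs_le.1 (hf1 ω)
  by_cases hω : ω ∈ A
  · have h0 : 0 ≤ (μ[h | m₁]) ω := hω
    simp only [signOn_of_mem hω]; nlinarith
  · have h0 : (μ[h | m₁]) ω < 0 := not_le.1 hω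
    simp only [signOn_of_notMem hω]; nlinarith

theorem covariance_le_four_mul_alphaCoeff (hm₁ : m₁ ≤ m0) (hm₂ : m₂ ≤ m0) {f g : Ω → ℝ}
    (hf : StronglyMeasurable[m₁] f) (hf1 : ∀ ω, ‖f ω‖ ≤ 1)
    (hg : StronglyMeasurable[m₂] g) (hg1 : ∀ ω, ‖g ω‖ ≤ 1) :
    cov[f, g; μ] ≤ 4 * alphaCoeff μ m₁ m₂ := by
  obtain ⟨A, hA, h1⟩ := exists_covariance_le_covariance_signOn hm₁ hf hf1
    (memLp_of_norm_le hm₂ hg hg1 (μ := μ))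
  obtain ⟨B, hB, h2⟩ := exists_covariance_le_covariance_signOn hm₂ hg hg1
    (memLp_of_norm_le hm₁ (stronglyMeasurable_signOn hA) (norm_signOn_le A) (μ := μ))
  rw [covariance_comm g, covariance_comm (signOn B)] at h2
  exact h1.trans (h2.trans (covariance_signOn_le hm₁ hm₂ hA hB))

end AlphaCoeff

/-! ### Grothendieck's inequality for covariances -/

section Grothendieck

open ProbabilityTheory

/-- Rademacher sums as an isometric embedding of `ℝ ^ d` into a finite `L²` space. The rows `s j`
are the `N = 2 ^ d` sign vectors of length `d`; for `j` uniformly random, `∑ i, s j i * u i` has second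
moment `‖u‖ ^ 2` and fourth moment at most `3 ‖u‖ ^ 4`. -/
theorem exists_rademacher (d : ℕ) : ∃ (N : ℕ) (s : Fin N → Fin d → ℝ), 0 < N ∧
    (∀ u v : Fin d → ℝ, ∑ j, (∑ i, s j i * u i) * (∑ i, s j i * v i) = N * ∑ i, u i * v i) ∧
    (∀ u : Fin d → ℝ, ∑ j, (∑ i, s j i * u i) ^ 4 ≤ N * (3 * (∑ i, u i ^ 2) ^ 2)) := by
  induction d with
  | zero => exact ⟨1, fun _ i => i.elim0, one_pos, by simp, by simp⟩
  | succ d ih =>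
    obtain ⟨N, s, hN, h2, h4⟩ := ih
    refine ⟨N + N, Fin.addCases (fun j => Fin.cons 1 (s j)) (fun j => Fin.cons (-1) (s j)),
      by omega, fun u v => ?_, fun u => ?_⟩
    · simp only [Fin.sum_univ_add, Fin.addCases_left, Fin.addCases_right, Fin.sum_univ_succ,
        Fin.cons_zero, Fin.cons_succ]
      have := h2 (fun i => u i.succ) (fun i => v i.succ)
      rw [← Finset.sum_add_distrib]
      calc _ = ∑ j : Fin N, (2 * (u 0 * v 0) +
            2 * ((∑ i, s j i * u i.succ) * (∑ i, s j i * v i.succ))) :=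
            Finset.sum_congr rfl fun j _ => by ring
        _ = _ := by
          rw [Finset.sum_add_distrib, ← Finset.mul_sum Finset.univ
            (fun j => (∑ i, s j i * u i.succ) * (∑ i, s j i * v i.succ)), this]
          simp only [Finset.sum_const, Finset.card_univ, Fintype.card_fin, nsmul_eq_mul]
          push_cast; ring
    · simp only [Fin.sum_univ_add, Fin.addCases_left, Fin.addCases_right, Fin.sum_univ_succ,
        Fin.cons_zero, Fin.cons_succ]
      have e2 := h2 (fun i => u i.succ) (fun i => u i.succ)
      have e4 := h4 (fun i => u i.succ)
      simp only [← pow_two] at e2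
      rw [← Finset.sum_add_distrib]
      calc _ = ∑ j : Fin N, (2 * u 0 ^ 4 + (12 * u 0 ^ 2) * (∑ i, s j i * u i.succ) ^ 2 +
            2 * (∑ i, s j i * u i.succ) ^ 4) :=
            Finset.sum_congr rfl fun j _ => by ring
        _ ≤ _ := by
          rw [Finset.sum_add_distrib, Finset.sum_add_distrib, ← Finset.mul_sum Finset.univ
            (fun j => (∑ i, s j i * u i.succ) ^ 2), ← Finset.mul_sum Finset.univ
            (fun j => (∑ i, s j i * u i.succ) ^ 4), e2]
          simp only [Finset.sum_const, Finset.card_univ, Fintype.card_fin, nsmul_eq_mul]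
          push_cast
          have : (0 : ℝ) ≤ N * u 0 ^ 4 := by positivity
          nlinarith

/-- Truncation of a real number to `[-2, 2]`. -/
noncomputable def clip (x : ℝ) : ℝ := max (-2) (min 2 x)

theorem abs_clip_le (x : ℝ) : |clip x| ≤ 2 :=
  abs_le.2 ⟨le_max_left _ _, max_le (by norm_num) (min_le_left _ _)⟩

theorem sq_clip_le (x : ℝ) : clip x ^ 2 ≤ x ^ 2 := by
  unfold clip
  rcases max_cases (-2) (min 2 x) with h | h <;> rcases min_cases 2 x with h' | h' <;>
    rw [h.1] <;> nlinarith

theorem sq_sub_clip_le (x : ℝ) : (x - clip x) ^ 2 ≤ x ^ 4 / 64 := by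
  have key : ∀ y : ℝ, 0 ≤ y → y ≤ x ^ 2 / 8 → y ^ 2 ≤ x ^ 4 / 64 := fun y h0 h1 => by
    nlinarith [mul_self_le_mul_self h0 h1]
  rcases le_total x (-2) with h | h
  · rw [clip, min_eq_right (by linarith), max_eq_left h]
    have := key (-(x - -2)) (by linarith) (by nlinarith [sq_nonneg (x + 4)])
    rwa [neg_sq] at this
  rcases le_total x 2 with h' | h'
  · rw [clip, min_eq_right h', max_eq_right h]
    have : 0 ≤ x ^ 4 := by positivity
    nlinarith
  · rw [clip, min_eq_left h', max_eq_right (by norm_num)]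
    exact key _ (by linarith) (by nlinarith [sq_nonneg (x - 4)])

theorem continuous_clip : Continuous clip := by unfold clip; fun_prop

variable {Ω : Type*} {m₁ m₂ : MeasurableSpace Ω} [m0 : MeasurableSpace Ω] {μ : Measure Ω}
  [IsProbabilityMeasure μ]

theorem covariance_le_half_integral_sq_add {f g : Ω → ℝ} (hf : MemLp f 2 μ) (hg : MemLp g 2 μ) :
    cov[f, g; μ] ≤ (μ[f ^ 2] + μ[g ^ 2]) / 2 := by
  have hf' : MemLp (fun ω => f ω - μ[f]) 2 μ := hf.sub (memLp_const _)
  have hg' : MemLp (fun ω => g ω - μ[g]) 2 μ := hg.sub (memLp_const _)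
  calc cov[f, g; μ] ≤ ∫ ω, ((f ω - μ[f]) ^ 2 + (g ω - μ[g]) ^ 2) / 2 ∂μ := by
        refine integral_mono (hf'.integrable_mul hg')
          ((hf'.integrable_sq.add hg'.integrable_sq).div_const 2) fun ω => ?_
        have := sq_nonneg ((f ω - μ[f]) - (g ω - μ[g]))
        simp only; nlinarith
    _ = (Var[f; μ] + Var[g; μ]) / 2 := by
        rw [integral_div, integral_add hf'.integrable_sq hg'.integrable_sq,
          variance_eq_integral hf.1.aemeasurable, variance_eq_integral hg.1.aemeasurable]
    _ ≤ _ := by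
        gcongr
        · exact variance_le_expectation_sq hf.1
        · exact variance_le_expectation_sq hg.1

/-- Bootstrap for Grothendieck's inequality: embedding `ℝ ^ d` isometrically into `L²` of the
signs and truncating there at level `2` splits off an explicit multiple of `α` and leaves two terms
of the same kind whose size is smaller by a factor `4`. The estimate is uniform in `d`. -/
theorem sum_covariance_le_alphaCoeff_add (hm₁ : m₁ ≤ m0) (hm₂ : m₂ ≤ m0) (k : ℕ) :
    ∀ (d : ℕ) (u v : Fin d → Ω → ℝ), (∀ i, StronglyMeasurable[m₁] (u i)) →
      (∀ ω, ∑ i, u i ω ^ 2 ≤ 1) → (∀ i, StronglyMeasurable[m₂] (v i)) →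
      (∀ ω, ∑ i, v i ω ^ 2 ≤ 1) →
      ∑ i, cov[u i, v i; μ] ≤ 32 * alphaCoeff μ m₁ m₂ + (1 / 2) ^ k := by
  -- bounds on the coordinates, for integrability
  have hbd : ∀ {d : ℕ} {u : Fin d → Ω → ℝ}, (∀ ω, ∑ i, u i ω ^ 2 ≤ 1) →
      ∀ i ω, ‖u i ω‖ ≤ 1 := by
    intro d u h i ω
    have := (Finset.single_le_sum (f := fun i => u i ω ^ 2) (fun i _ => sq_nonneg _)
      (Finset.mem_univ i)).trans (h ω)
    exact abs_le_one_iff_mul_self_le_one.2 (by simpa [pow_two] using this)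
  induction k with
  | zero =>
    intro d u v hu hu1 hv hv1
    have mu := fun i => memLp_of_norm_le (p := 2) (μ := μ) hm₁ (hu i) (hbd hu1 i)
    have mv := fun i => memLp_of_norm_le (p := 2) (μ := μ) hm₂ (hv i) (hbd hv1 i)
    have hsum : ∀ {w : Fin d → Ω → ℝ}, (∀ i, MemLp (w i) 2 μ) → (∀ ω, ∑ i, w i ω ^ 2 ≤ 1) →
        ∑ i, μ[w i ^ 2] ≤ 1 := by
      intro w mw hw
      have hi : ∀ i ∈ Finset.univ, Integrable (w i ^ 2) μ := fun i _ => (mw i).integrable_sq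
      rw [← integral_finsetSum _ hi]
      calc _ ≤ ∫ _, (1 : ℝ) ∂μ :=
            integral_mono (integrable_finsetSum _ hi) (integrable_const _) fun ω => by
              simpa using hw ω
        _ = 1 := by simp
    calc ∑ i, cov[u i, v i; μ] ≤ ∑ i, (μ[u i ^ 2] + μ[v i ^ 2]) / 2 :=
          Finset.sum_le_sum fun i _ => covariance_le_half_integral_sq_add (mu i) (mv i)
      _ = (∑ i, μ[u i ^ 2] + ∑ i, μ[v i ^ 2]) / 2 := by
          rw [← Finset.sum_div, Finset.sum_add_distrib]
      _ ≤ _ := by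
          have := alphaCoeff_nonneg (μ := μ) (m₁ := m₁) (m₂ := m₂)
          have := hsum mu hu1
          have := hsum mv hv1
          simp only [pow_zero]
          linarith
  | succ k ih =>
    intro d u v hu hu1 hv hv1
    obtain ⟨N, s, hN, h2, h4⟩ := exists_rademacher d
    have hN' : (0 : ℝ) < N := by exact_mod_cast hN
    set X : Fin N → Ω → ℝ := fun j ω => ∑ i, s j i * u i ω with hX
    set Y : Fin N → Ω → ℝ := fun j ω => ∑ i, s j i * v i ω with hY
    have mu := fun i => memLp_of_norm_le (p := 2) (μ := μ) hm₁ (hu i) (hbd hu1 i)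
    have mv := fun i => memLp_of_norm_le (p := 2) (μ := μ) hm₂ (hv i) (hbd hv1 i)
    have sX : ∀ j, StronglyMeasurable[m₁] (X j) := fun j =>
      Finset.stronglyMeasurable_fun_sum _ fun i _ => (hu i).const_mul _
    have sY : ∀ j, StronglyMeasurable[m₂] (Y j) := fun j =>
      Finset.stronglyMeasurable_fun_sum _ fun i _ => (hv i).const_mul _
    have mX : ∀ j, MemLp (X j) 2 μ := fun j => memLp_finsetSum _ fun i _ => (mu i).const_mul _
    have mY : ∀ j, MemLp (Y j) 2 μ := fun j => memLp_finsetSum _ fun i _ => (mv i).const_mul _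
    have scX : ∀ j, StronglyMeasurable[m₁] (fun ω => clip (X j ω)) := fun j =>
      continuous_clip.comp_stronglyMeasurable (sX j)
    have scY : ∀ j, StronglyMeasurable[m₂] (fun ω => clip (Y j ω)) := fun j =>
      continuous_clip.comp_stronglyMeasurable (sY j)
    have mcX : ∀ j, MemLp (fun ω => clip (X j ω)) 2 μ := fun j =>
      memLp_of_norm_le hm₁ (scX j) fun ω => abs_clip_le _
    have mcY : ∀ j, MemLp (fun ω => clip (Y j ω)) 2 μ := fun j =>
      memLp_of_norm_le hm₂ (scY j) fun ω => abs_clip_le _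
    -- the isometry of the embedding, at the level of covariances
    have hiso : N * ∑ i, cov[u i, v i; μ] = ∑ j, cov[X j, Y j; μ] := by
      have hc : ∀ j, cov[X j, Y j; μ] = ∫ ω, (∑ i, s j i * (u i ω - μ[u i])) *
          (∑ i, s j i * (v i ω - μ[v i])) ∂μ := by
        intro j
        have e1 : μ[X j] = ∑ i, s j i * μ[u i] := by
          simp only [hX]
          rw [integral_finsetSum _ fun i _ => ((mu i).integrable (by norm_num)).const_mul _]
          simp only [integral_const_mul]
        have e2 : μ[Y j] = ∑ i, s j i * μ[v i] := by
          simp only [hY]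
          rw [integral_finsetSum _ fun i _ => ((mv i).integrable (by norm_num)).const_mul _]
          simp only [integral_const_mul]
        rw [covariance, e1, e2]
        simp only [hX, hY, mul_sub, Finset.sum_sub_distrib]
      have mu' : ∀ i, MemLp (fun ω => u i ω - μ[u i]) 2 μ := fun i => (mu i).sub (memLp_const _)
      have mv' : ∀ i, MemLp (fun ω => v i ω - μ[v i]) 2 μ := fun i => (mv i).sub (memLp_const _)
      have i1 : ∀ i, Integrable (fun ω => (u i ω - μ[u i]) * (v i ω - μ[v i])) μ := fun i =>
        (mu' i).integrable_mul (mv' i)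
      have i2 : ∀ j, Integrable (fun ω => (∑ i, s j i * (u i ω - μ[u i])) *
          (∑ i, s j i * (v i ω - μ[v i]))) μ := fun j =>
        MemLp.integrable_mul (memLp_finsetSum _ fun i _ => (mu' i).const_mul _)
          (memLp_finsetSum _ fun i _ => (mv' i).const_mul _)
      simp only [hc]
      rw [← integral_finsetSum _ fun j _ => i2 j]
      simp only [h2]
      rw [integral_const_mul, integral_finsetSum _ fun i _ => i1 i]
      rfl
    have hsplit : ∀ j, cov[X j, Y j; μ] = cov[fun ω => clip (X j ω), fun ω => clip (Y j ω); μ] +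
        cov[fun ω => X j ω - clip (X j ω), fun ω => clip (Y j ω); μ] +
        cov[X j, fun ω => Y j ω - clip (Y j ω); μ] := by
      intro j
      rw [covariance_fun_sub_left (mX j) (mcX j) (mcY j),
        covariance_fun_sub_right (mX j) (mY j) (mcY j)]
      ring
    have hmain : ∀ j, cov[fun ω => clip (X j ω), fun ω => clip (Y j ω); μ] ≤
        16 * alphaCoeff μ m₁ m₂ := by
      intro j
      have := covariance_le_four_mul_alphaCoeff (μ := μ) hm₁ hm₂ ((scX j).const_mul (1 / 2))
        (fun ω => by
          rw [norm_mul, Real.norm_eq_abs (clip _)]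
          have := abs_clip_le (X j ω)
          norm_num; linarith)
        ((scY j).const_mul (1 / 2)) (fun ω => by
          rw [norm_mul, Real.norm_eq_abs (clip _)]
          have := abs_clip_le (Y j ω)
          norm_num; linarith)
      rw [covariance_const_mul_left, covariance_const_mul_right] at this
      linarith
    -- the two remainders: rescaled, they satisfy the assumptions in dimension `N`
    set r : ℝ := (Real.sqrt N)⁻¹ with hr
    have hr2 : r ^ 2 = (N : ℝ)⁻¹ := by rw [hr, inv_pow, Real.sq_sqrt hN'.le]
    have hsq : ∀ (w : Fin d → ℝ), ∑ i, w i ^ 2 ≤ 1 →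
        (∑ j, (r * clip (∑ i, s j i * w i)) ^ 2 ≤ 1 ∧ ∑ j, (r * ∑ i, s j i * w i) ^ 2 ≤ 1) ∧
        ∑ j, (4 * r * ((∑ i, s j i * w i) - clip (∑ i, s j i * w i))) ^ 2 ≤ 1 := by
      intro w hw
      have e2 := h2 w w
      have e4 := h4 w
      simp only [← pow_two] at e2
      have hB : ∑ j, (r * ∑ i, s j i * w i) ^ 2 ≤ 1 := by
        simp only [mul_pow, hr2, ← Finset.mul_sum, e2]
        rwa [inv_mul_cancel_left₀ hN'.ne']
      refine ⟨⟨le_trans (Finset.sum_le_sum fun j _ => ?_) hB, hB⟩, ?_⟩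
      · rw [mul_pow, mul_pow]
        gcongr ?_ * ?_
        exact sq_clip_le _
      · calc _ ≤ ∑ j, (N : ℝ)⁻¹ / 4 * (∑ i, s j i * w i) ^ 4 := by
              refine Finset.sum_le_sum fun j _ => ?_
              rw [mul_pow, mul_pow, hr2]
              have := sq_sub_clip_le (∑ i, s j i * w i)
              have h0 : (0 : ℝ) < (N : ℝ)⁻¹ := inv_pos.2 hN'
              nlinarith
          _ ≤ (N : ℝ)⁻¹ / 4 * (N * (3 * (∑ i, w i ^ 2) ^ 2)) := by
              rw [← Finset.mul_sum]; gcongr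
          _ = 3 / 4 * (∑ i, w i ^ 2) ^ 2 := by field_simp
          _ ≤ 1 := by
              have : 0 ≤ ∑ i, w i ^ 2 := Finset.sum_nonneg fun i _ => sq_nonneg _
              nlinarith
    have hrem1 := ih N (fun j ω => 4 * r * (X j ω - clip (X j ω))) (fun j ω => r * clip (Y j ω))
      (fun j => ((sX j).sub (scX j)).const_mul _) (fun ω => (hsq _ (hu1 ω)).2)
      (fun j => (scY j).const_mul _) (fun ω => (hsq _ (hv1 ω)).1.1)
    have hrem2 := ih N (fun j ω => r * X j ω) (fun j ω => 4 * r * (Y j ω - clip (Y j ω)))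
      (fun j => (sX j).const_mul _) (fun ω => (hsq _ (hu1 ω)).1.2)
      (fun j => ((sY j).sub (scY j)).const_mul _) (fun ω => (hsq _ (hv1 ω)).2)
    simp only [covariance_const_mul_left, covariance_const_mul_right,
      ← Finset.mul_sum] at hrem1 hrem2
    have hsum : ∑ j, cov[X j, Y j; μ] ≤ N * (16 * alphaCoeff μ m₁ m₂) +
        ∑ j, cov[fun ω => X j ω - clip (X j ω), fun ω => clip (Y j ω); μ] +
        ∑ j, cov[X j, fun ω => Y j ω - clip (Y j ω); μ] := by
      simp only [hsplit, Finset.sum_add_distrib]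
      gcongr
      calc _ ≤ ∑ _j : Fin N, 16 * alphaCoeff μ m₁ m₂ := Finset.sum_le_sum fun j _ => hmain j
        _ = _ := by simp
    rw [← hiso] at hsum
    generalize ∑ j, cov[fun ω => X j ω - clip (X j ω), fun ω => clip (Y j ω); μ] = R₁ at *
    generalize ∑ j, cov[X j, fun ω => Y j ω - clip (Y j ω); μ] = R₂ at *
    generalize ∑ i, cov[u i, v i; μ] = S at *
    have f1 : 4 * (N : ℝ)⁻¹ * R₁ ≤ 32 * alphaCoeff μ m₁ m₂ + (1 / 2) ^ k := by
      rw [← hr2]; linarith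
    have f2 : 4 * (N : ℝ)⁻¹ * R₂ ≤ 32 * alphaCoeff μ m₁ m₂ + (1 / 2) ^ k := by
      rw [← hr2]; linarith
    have f3 : S ≤ 16 * alphaCoeff μ m₁ m₂ + (N : ℝ)⁻¹ * R₁ + (N : ℝ)⁻¹ * R₂ := by
      have := mul_le_mul_of_nonneg_left hsum (inv_pos.2 hN').le
      rw [inv_mul_cancel_left₀ hN'.ne', mul_add, mul_add, inv_mul_cancel_left₀ hN'.ne'] at this
      exact this
    rw [pow_succ]
    linarith

theorem sum_covariance_le_alphaCoeff (hm₁ : m₁ ≤ m0) (hm₂ : m₂ ≤ m0) {d : ℕ}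
    {u v : Fin d → Ω → ℝ} (hu : ∀ i, StronglyMeasurable[m₁] (u i))
    (hu1 : ∀ ω, ∑ i, u i ω ^ 2 ≤ 1) (hv : ∀ i, StronglyMeasurable[m₂] (v i))
    (hv1 : ∀ ω, ∑ i, v i ω ^ 2 ≤ 1) :
    ∑ i, cov[u i, v i; μ] ≤ 32 * alphaCoeff μ m₁ m₂ := by
  have hlim : Tendsto (fun k : ℕ => 32 * alphaCoeff μ m₁ m₂ + (1 / 2 : ℝ) ^ k) atTop
      (𝓝 (32 * alphaCoeff μ m₁ m₂ + 0)) :=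
    (tendsto_pow_atTop_nhds_zero_of_lt_one (by norm_num) (by norm_num)).const_add _
  rw [add_zero] at hlim
  exact ge_of_tendsto' hlim fun k =>
    sum_covariance_le_alphaCoeff_add hm₁ hm₂ k d u v hu hu1 hv hv1

section FiniteDimensional

variable {F : Type*} [NormedAddCommGroup F] [InnerProductSpace ℝ F] [FiniteDimensional ℝ F]

theorem integral_inner_sub_le_of_finiteDimensional (hm₁ : m₁ ≤ m0) (hm₂ : m₂ ≤ m0) {U V : Ω → F}
    (hU : StronglyMeasurable[m₁] U) (hU1 : ∀ ω, ‖U ω‖ ≤ 1) (hV : StronglyMeasurable[m₂] V)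
    (hV1 : ∀ ω, ‖V ω‖ ≤ 1) :
    ∫ ω, inner ℝ (U ω) (V ω) ∂μ - inner ℝ (∫ ω, U ω ∂μ) (∫ ω, V ω ∂μ) ≤
      32 * alphaCoeff μ m₁ m₂ := by
  have : CompleteSpace F := FiniteDimensional.complete ℝ F
  let b := stdOrthonormalBasis ℝ F
  have sm : ∀ {m : MeasurableSpace Ω} {W : Ω → F}, StronglyMeasurable[m] W →
      ∀ i, StronglyMeasurable[m] fun ω => inner ℝ (b i) (W ω) := fun h i =>
    stronglyMeasurable_const.inner h
  have sq : ∀ {W : Ω → F}, (∀ ω, ‖W ω‖ ≤ 1) → ∀ ω, ∑ i, inner ℝ (b i) (W ω) ^ 2 ≤ 1 := by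
    intro W hW ω
    have := b.sum_sq_norm_inner_right (W ω)
    simp only [Real.norm_eq_abs, sq_abs] at this
    rw [this]
    exact pow_le_one₀ (norm_nonneg _) (hW ω)
  have bd : ∀ {W : Ω → F}, (∀ ω, ‖W ω‖ ≤ 1) → ∀ i ω, ‖inner ℝ (b i) (W ω)‖ ≤ 1 := by
    intro W hW i ω
    refine (norm_inner_le_norm _ _).trans ?_
    rw [b.norm_eq_one, one_mul]
    exact hW ω
  have key := sum_covariance_le_alphaCoeff (μ := μ) hm₁ hm₂ (sm hU) (sq hU1) (sm hV) (sq hV1)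
  have mU : ∀ i, MemLp (fun ω => inner ℝ (b i) (U ω)) 2 μ := fun i =>
    memLp_of_norm_le hm₁ (sm hU i) (bd hU1 i)
  have mV : ∀ i, MemLp (fun ω => inner ℝ (b i) (V ω)) 2 μ := fun i =>
    memLp_of_norm_le hm₂ (sm hV i) (bd hV1 i)
  have iU : Integrable U μ := (memLp_of_norm_le hm₁ hU hU1).integrable le_rfl
  have iV : Integrable V μ := (memLp_of_norm_le hm₂ hV hV1).integrable le_rfl
  refine le_trans (le_of_eq ?_) key
  simp only [covariance_eq_sub (mU _) (mV _), integral_inner iU, integral_inner iV]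
  rw [Finset.sum_sub_distrib, ← integral_finsetSum _ fun i _ => (mU i).integrable_mul (mV i),
    ← b.sum_inner_mul_inner]
  congr 1
  · refine integral_congr_ae (ae_of_all _ fun ω => ?_)
    simp only [Pi.mul_apply]
    rw [← b.sum_inner_mul_inner]
    simp only [real_inner_comm]
  · simp only [real_inner_comm]

end FiniteDimensional

variable {G : Type*} [NormedAddCommGroup G] [InnerProductSpace ℝ G] [CompleteSpace G]

theorem integral_inner_sub_le_of_simpleFunc (hm₁ : m₁ ≤ m0) (hm₂ : m₂ ≤ m0)
    (U : @SimpleFunc Ω m₁ G) (V : @SimpleFunc Ω m₂ G) (hU1 : ∀ ω, ‖U ω‖ ≤ 1)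
    (hV1 : ∀ ω, ‖V ω‖ ≤ 1) :
    ∫ ω, inner ℝ (U ω) (V ω) ∂μ - inner ℝ (∫ ω, U ω ∂μ) (∫ ω, V ω ∂μ) ≤
      32 * alphaCoeff μ m₁ m₂ := by
  let S : Submodule ℝ G := Submodule.span ℝ (Set.range U ∪ Set.range V)
  have : FiniteDimensional ℝ S :=
    FiniteDimensional.span_of_finite ℝ ((@SimpleFunc.finite_range _ _ m₁ U).union
      (@SimpleFunc.finite_range _ _ m₂ V))
  have hUS : ∀ ω, U ω ∈ S := fun ω => Submodule.subset_span (Or.inl ⟨ω, rfl⟩)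
  have hVS : ∀ ω, V ω ∈ S := fun ω => Submodule.subset_span (Or.inr ⟨ω, rfl⟩)
  let U' : Ω → S := fun ω => ⟨U ω, hUS ω⟩
  let V' : Ω → S := fun ω => ⟨V ω, hVS ω⟩
  have hU' : StronglyMeasurable[m₁] U' := by
    have : U' = fun ω => S.orthogonalProjectionOnto (U ω) := funext fun ω =>
      (S.orthogonalProjectionOnto_mem_subspace_eq_self (U' ω)).symm
    rw [this]
    exact S.orthogonalProjectionOnto.continuous.comp_stronglyMeasurable U.stronglyMeasurable
  have hV' : StronglyMeasurable[m₂] V' := by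
    have : V' = fun ω => S.orthogonalProjectionOnto (V ω) := funext fun ω =>
      (S.orthogonalProjectionOnto_mem_subspace_eq_self (V' ω)).symm
    rw [this]
    exact S.orthogonalProjectionOnto.continuous.comp_stronglyMeasurable V.stronglyMeasurable
  have iU : Integrable U' μ := (memLp_of_norm_le hm₁ hU' hU1).integrable le_rfl
  have iV : Integrable V' μ := (memLp_of_norm_le hm₂ hV' hV1).integrable le_rfl
  have key := integral_inner_sub_le_of_finiteDimensional (μ := μ) hm₁ hm₂ hU' hU1 hV' hV1
  have eU : ∫ ω, U ω ∂μ = ((∫ ω, U' ω ∂μ : S) : G) := S.subtypeL.integral_comp_comm iU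
  have eV : ∫ ω, V ω ∂μ = ((∫ ω, V' ω ∂μ : S) : G) := S.subtypeL.integral_comp_comm iV
  rw [eU, eV]
  exact key

/-- Covariance inequality for strongly mixing `σ`-fields and functions with values in the unit ball
of a Hilbert space, with a constant that does not depend on the dimension. -/
theorem integral_inner_sub_le_of_norm_le_one (hm₁ : m₁ ≤ m0) (hm₂ : m₂ ≤ m0) {U V : Ω → G}
    (hU : StronglyMeasurable[m₁] U) (hU1 : ∀ ω, ‖U ω‖ ≤ 1) (hV : StronglyMeasurable[m₂] V)
    (hV1 : ∀ ω, ‖V ω‖ ≤ 1) :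
    ∫ ω, inner ℝ (U ω) (V ω) ∂μ - inner ℝ (∫ ω, U ω ∂μ) (∫ ω, V ω ∂μ) ≤
      32 * alphaCoeff μ m₁ m₂ := by
  have tU : ∀ ω, Tendsto (fun n => hU.approxBounded 1 n ω) atTop (𝓝 (U ω)) := fun ω =>
    hU.tendsto_approxBounded_of_norm_le (hU1 ω)
  have tV : ∀ ω, Tendsto (fun n => hV.approxBounded 1 n ω) atTop (𝓝 (V ω)) := fun ω =>
    hV.tendsto_approxBounded_of_norm_le (hV1 ω)
  have bU := fun n ω => hU.norm_approxBounded_le zero_le_one n ω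
  have bV := fun n ω => hV.norm_approxBounded_le zero_le_one n ω
  have sU := fun n => ((hU.approxBounded 1 n).stronglyMeasurable.mono hm₁).aestronglyMeasurable
    (μ := μ)
  have sV := fun n => ((hV.approxBounded 1 n).stronglyMeasurable.mono hm₂).aestronglyMeasurable
    (μ := μ)
  have lU := tendsto_integral_of_dominated_convergence (fun _ => (1 : ℝ)) sU
    (integrable_const _) (fun n => ae_of_all μ (bU n)) (ae_of_all _ tU)
  have lV := tendsto_integral_of_dominated_convergence (fun _ => (1 : ℝ)) sV
    (integrable_const _) (fun n => ae_of_all μ (bV n)) (ae_of_all _ tV)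
  have lUV := tendsto_integral_of_dominated_convergence (μ := μ)
    (F := fun n ω => inner ℝ (hU.approxBounded 1 n ω) (hV.approxBounded 1 n ω))
    (f := fun ω => inner ℝ (U ω) (V ω)) (fun _ => (1 : ℝ))
    (fun n => (sU n).inner (sV n)) (integrable_const _)
    (fun n => ae_of_all μ fun ω => (norm_inner_le_norm _ _).trans
      (mul_le_one₀ (bU n ω) (norm_nonneg _) (bV n ω)))
    (ae_of_all _ fun ω => (tU ω).inner (tV ω))
  exact le_of_tendsto' (lUV.sub (lU.inner lV)) fun n =>
    integral_inner_sub_le_of_simpleFunc hm₁ hm₂ _ _ (bU n) (bV n)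

theorem integral_inner_sub_le_alphaCoeff (hm₁ : m₁ ≤ m0) (hm₂ : m₂ ≤ m0) {U V : Ω → G} {a b : ℝ}
    (hU : StronglyMeasurable[m₁] U) (hUa : ∀ ω, ‖U ω‖ ≤ a) (hV : StronglyMeasurable[m₂] V)
    (hVb : ∀ ω, ‖V ω‖ ≤ b) :
    ∫ ω, inner ℝ (U ω) (V ω) ∂μ - inner ℝ (∫ ω, U ω ∂μ) (∫ ω, V ω ∂μ) ≤
      32 * alphaCoeff μ m₁ m₂ * (a * b) := by
  have hΩ : Nonempty Ω := nonempty_of_isProbabilityMeasure μ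
  have ha : 0 ≤ a := (norm_nonneg _).trans (hUa hΩ.some)
  have hb : 0 ≤ b := (norm_nonneg _).trans (hVb hΩ.some)
  rcases ha.eq_or_lt with rfl | ha
  · have : U = 0 := funext fun ω => norm_le_zero_iff.1 (hUa ω)
    simp [this]
  rcases hb.eq_or_lt with rfl | hb
  · have : V = 0 := funext fun ω => norm_le_zero_iff.1 (hVb ω)
    simp [this]
  have key := integral_inner_sub_le_of_norm_le_one (μ := μ) hm₁ hm₂ (hU.const_smul a⁻¹)
    (fun ω => by
      rw [Pi.smul_apply, norm_smul, norm_inv, Real.norm_of_nonneg ha.le, inv_mul_le_iff₀ ha,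
        mul_one]
      exact hUa ω)
    (hV.const_smul b⁻¹) (fun ω => by
      rw [Pi.smul_apply, norm_smul, norm_inv, Real.norm_of_nonneg hb.le, inv_mul_le_iff₀ hb,
        mul_one]
      exact hVb ω)
  simp only [Pi.smul_apply, inner_smul_left, inner_smul_right, integral_smul, integral_const_mul,
    RCLike.conj_to_real] at key
  have h2 := mul_le_mul_of_nonneg_right key (mul_pos ha hb).le
  have e : ∀ x y : ℝ, (b⁻¹ * (a⁻¹ * x) - b⁻¹ * (a⁻¹ * y)) * (a * b) = x - y := by
    intro x y; field_simp
  rwa [e] at h2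

end Grothendieck

/-! ### Exponential inequality for Hilbert-valued martingales -/

section Pinelis

open ProbabilityTheory

theorem convexOn_cosh_sqrt : ConvexOn ℝ (Set.Ici 0) fun s : ℝ => Real.cosh (√s) := by
  have hs : ∀ s : ℝ, 0 ≤ s → HasSum (fun n : ℕ => s ^ n / ((2 * n).factorial : ℝ))
      (Real.cosh (√s)) := by
    intro s h
    have := Real.hasSum_cosh (√s)
    simpa only [pow_mul, Real.sq_sqrt h] using this
  refine ⟨convex_Ici 0, fun x hx y hy a b ha hb hab => ?_⟩
  have hx : 0 ≤ x := hx
  have hy : 0 ≤ y := hy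
  have hxy : 0 ≤ a • x + b • y := by simp only [smul_eq_mul]; positivity
  refine hasSum_le (fun n => ?_) (hs _ hxy)
    (((hs x hx).const_smul a).add ((hs y hy).const_smul b))
  have := (convexOn_pow n).2 hx hy ha hb hab
  simp only [smul_eq_mul] at this ⊢
  rw [mul_div_assoc', mul_div_assoc', ← add_div]
  gcongr

variable {G : Type*} [NormedAddCommGroup G] [InnerProductSpace ℝ G]

theorem convexOn_cosh_norm : ConvexOn ℝ Set.univ fun x : G => Real.cosh ‖x‖ := by
  have hc : ConvexOn ℝ Set.univ Real.cosh := by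
    refine ⟨convex_univ, fun x _ y _ a b ha hb hab => ?_⟩
    have h1 := convexOn_exp.2 (Set.mem_univ x) (Set.mem_univ y) ha hb hab
    have h2 := convexOn_exp.2 (Set.mem_univ (-x)) (Set.mem_univ (-y)) ha hb hab
    simp only [smul_eq_mul, Real.cosh_eq] at *
    have e : -(a * x + b * y) = a * -x + b * -y := by ring
    rw [e]
    linarith
  refine ⟨convex_univ, fun x _ y _ a b ha hb hab => ?_⟩
  have h1 := convexOn_univ_norm.2 (Set.mem_univ x) (Set.mem_univ y) ha hb hab
  refine le_trans ?_ (hc.2 (Set.mem_univ ‖x‖) (Set.mem_univ ‖y‖) ha hb hab)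
  refine Real.cosh_le_cosh.2 ?_
  rw [abs_of_nonneg (norm_nonneg _)]
  exact h1.trans (le_abs_self _)

/-- The coefficient of the linear term in `cosh_norm_add_le`: a multiple of `x`, with the value `0`
at `x = 0` and for `B = 0` by the convention for division by zero. -/
noncomputable def coshField (B : ℝ) (x : G) : G := (Real.sinh ‖x‖ * Real.sinh B / (‖x‖ * B)) • x

/-- `cosh ‖x + y‖` is a convex function of `⟪x, y⟫` for fixed norms, hence lies below its chord over
`|⟪x, y⟫| ≤ ‖x‖ B`; the slope of this chord depends on `x` alone. -/
theorem cosh_norm_add_le {B : ℝ} (x y : G) (hy : ‖y‖ ≤ B) :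
    Real.cosh ‖x + y‖ ≤ Real.cosh ‖x‖ * Real.cosh B + inner ℝ (coshField B x) y := by
  have hB : 0 ≤ B := (norm_nonneg y).trans hy
  rcases eq_or_ne x 0 with rfl | hx
  · simp only [zero_add, norm_zero, Real.cosh_zero, one_mul, coshField, smul_zero,
      inner_zero_left, add_zero]
    rw [Real.cosh_le_cosh, abs_of_nonneg (norm_nonneg _), abs_of_nonneg hB]
    exact hy
  rcases hB.eq_or_lt with rfl | hB
  · have : y = 0 := norm_le_zero_iff.1 hy
    simp [this]
  have ha : 0 < ‖x‖ := norm_pos_iff.2 hx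
  set a := ‖x‖ with ha_def
  have hin : |inner ℝ x y| ≤ a * B :=
    (abs_real_inner_le_norm x y).trans (mul_le_mul_of_nonneg_left hy ha.le)
  set u : ℝ := inner ℝ x y / (a * B) with hu
  have hab : 0 < a * B := mul_pos ha hB
  have hxy : inner ℝ x y = u * (a * B) := by rw [hu, div_mul_cancel₀ _ hab.ne']
  have hu1 : |u| ≤ 1 := by
    rw [hu, abs_div, abs_of_pos hab]
    exact div_le_one_of_le₀ hin hab.le
  obtain ⟨hl, hr⟩ := abs_le.1 hu1
  have hconv := convexOn_cosh_sqrt.2 (Set.mem_Ici.2 (sq_nonneg (a + B)))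
    (Set.mem_Ici.2 (sq_nonneg (a - B))) (by linarith : 0 ≤ (1 + u) / 2)
    (by linarith : 0 ≤ (1 - u) / 2) (by ring)
  simp only [smul_eq_mul, Real.sqrt_sq_eq_abs, Real.cosh_abs] at hconv
  have hs : (1 + u) / 2 * (a + B) ^ 2 + (1 - u) / 2 * (a - B) ^ 2 =
      a ^ 2 + 2 * inner ℝ x y + B ^ 2 := by rw [hxy]; ring
  rw [hs] at hconv
  have hle : ‖x + y‖ ≤ √(a ^ 2 + 2 * inner ℝ x y + B ^ 2) := by
    refine Real.le_sqrt_of_sq_le ?_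
    rw [norm_add_sq_real]
    gcongr
  calc Real.cosh ‖x + y‖ ≤ Real.cosh (√(a ^ 2 + 2 * inner ℝ x y + B ^ 2)) := by
        rw [Real.cosh_le_cosh, abs_of_nonneg (norm_nonneg _), abs_of_nonneg (Real.sqrt_nonneg _)]
        exact hle
    _ ≤ _ := hconv
    _ = _ := by
        rw [coshField, inner_smul_left, RCLike.conj_to_real, hxy, Real.cosh_add, Real.cosh_sub,
          ← ha_def]
        field_simp
        ring

theorem norm_coshField_le {B R : ℝ} (hB : 0 ≤ B) {x : G} (hx : ‖x‖ ≤ R) :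
    ‖coshField B x‖ ≤ Real.sinh R * Real.sinh B / B := by
  have hs : 0 ≤ Real.sinh B := Real.sinh_nonneg_iff.2 hB
  have hR : 0 ≤ Real.sinh R := Real.sinh_nonneg_iff.2 ((norm_nonneg x).trans hx)
  have hx' : 0 ≤ Real.sinh ‖x‖ := Real.sinh_nonneg_iff.2 (norm_nonneg x)
  rcases eq_or_ne x 0 with rfl | h
  · simp only [coshField, smul_zero, norm_zero]; positivity
  have ha : 0 < ‖x‖ := norm_pos_iff.2 h
  rw [coshField, norm_smul, Real.norm_of_nonneg (by positivity)]
  calc _ = Real.sinh ‖x‖ * Real.sinh B / B := by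
        rcases hB.eq_or_lt with rfl | hB
        · simp
        · field_simp
    _ ≤ _ := by
        gcongr
        exact Real.sinh_le_sinh.2 hx

theorem stronglyMeasurable_coshField {Ω : Type*} {m₁ : MeasurableSpace Ω} (B : ℝ)
    {Z : Ω → G} (hZ : StronglyMeasurable[m₁] Z) :
    StronglyMeasurable[m₁] fun ω => coshField B (Z ω) := by
  refine StronglyMeasurable.smul ?_ hZ
  refine Measurable.stronglyMeasurable ?_
  exact ((Real.measurable_sinh.comp hZ.norm.measurable).mul_const _).div
    (hZ.norm.measurable.mul_const _)

variable [CompleteSpace G] {Ω : Type*} {m₁ : MeasurableSpace Ω} [m0 : MeasurableSpace Ω]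
  {μ : Measure Ω} [IsProbabilityMeasure μ]

theorem integral_inner_condExp (hm : m₁ ≤ m0) {f g : Ω → G} {a : ℝ}
    (hf : StronglyMeasurable[m₁] f) (hfa : ∀ᵐ ω ∂μ, ‖f ω‖ ≤ a) (hg : Integrable g μ) :
    ∫ ω, inner ℝ (f ω) ((μ[g | m₁]) ω) ∂μ = ∫ ω, inner ℝ (f ω) (g ω) ∂μ := by
  have h : μ[fun ω => inner ℝ (f ω) (g ω) | m₁] =ᵐ[μ] fun ω => inner ℝ (f ω) ((μ[g | m₁]) ω) :=
    condExp_stronglyMeasurable_bilin_of_bound (innerSL ℝ) hm hf hg a hfa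
  rw [← integral_condExp hm (f := fun ω => inner ℝ (f ω) (g ω))]
  exact (integral_congr_ae h).symm

/-- Exponential moment of a Hilbert-valued martingale with bounded increments: each increment
contributes at most a factor `cosh B` to the mean of `cosh ‖·‖`. -/
theorem integral_cosh_norm_sum_le (S : Finset ℕ) (d : ℕ → Ω → G) (m : ℕ → MeasurableSpace Ω)
    (hm : ∀ t, m t ≤ m0) {B : ℝ} (hd : ∀ t, StronglyMeasurable (d t))
    (hdB : ∀ t, ∀ᵐ ω ∂μ, ‖d t ω‖ ≤ B)
    (hadapt : ∀ s ∈ S, ∀ t ∈ S, s < t → StronglyMeasurable[m t] (d s))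
    (hmart : ∀ t ∈ S, μ[d t | m t] =ᵐ[μ] 0) :
    ∫ ω, Real.cosh ‖∑ t ∈ S, d t ω‖ ∂μ ≤ Real.cosh B ^ S.card := by
  have hB : 0 ≤ B := by
    obtain ⟨ω, hω⟩ := (hdB 0).exists
    exact (norm_nonneg _).trans hω
  have hsm : ∀ T : Finset ℕ, StronglyMeasurable fun ω => ∑ t ∈ T, d t ω := fun T =>
    Finset.stronglyMeasurable_fun_sum _ fun t _ => hd t
  have hbd : ∀ T : Finset ℕ, ∀ᵐ ω ∂μ, ‖∑ t ∈ T, d t ω‖ ≤ T.card * B := by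
    intro T
    filter_upwards [ae_all_iff.2 hdB] with ω hω
    refine (norm_sum_le _ _).trans ?_
    rw [← nsmul_eq_mul]
    exact Finset.sum_le_card_nsmul _ _ _ fun t _ => hω t
  have hint : ∀ T : Finset ℕ, Integrable (fun ω => Real.cosh ‖∑ t ∈ T, d t ω‖) μ := by
    intro T
    refine Integrable.of_bound
      (Real.continuous_cosh.comp_stronglyMeasurable (hsm T).norm).aestronglyMeasurable
      (Real.cosh (T.card * B)) ?_
    filter_upwards [hbd T] with ω hω
    rw [Real.norm_of_nonneg (Real.cosh_pos _).le, Real.cosh_le_cosh,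
      abs_of_nonneg (norm_nonneg _), abs_of_nonneg (by positivity)]
    exact hω
  induction S using Finset.induction_on_max with
  | empty => simp
  | insert t S hS ih =>
    have htS : t ∉ S := fun h => lt_irrefl _ (hS t h)
    have ih := ih (fun s hs u hu => hadapt s (Finset.mem_insert_of_mem hs) u
      (Finset.mem_insert_of_mem hu)) fun u hu => hmart u (Finset.mem_insert_of_mem hu)
    have hZ : StronglyMeasurable[m t] fun ω => ∑ s ∈ S, d s ω :=
      Finset.stronglyMeasurable_fun_sum _ fun s hs =>
        hadapt s (Finset.mem_insert_of_mem hs) t (Finset.mem_insert_self _ _) (hS s hs)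
    have hg := stronglyMeasurable_coshField B hZ
    have hgb : ∀ᵐ ω ∂μ, ‖coshField B (∑ s ∈ S, d s ω)‖ ≤
        Real.sinh (S.card * B) * Real.sinh B / B := by
      filter_upwards [hbd S] with ω hω using norm_coshField_le hB hω
    have hdi : Integrable (d t) μ := Integrable.of_bound (hd t).aestronglyMeasurable B (hdB t)
    have hzero : ∫ ω, inner ℝ (coshField B (∑ s ∈ S, d s ω)) (d t ω) ∂μ = 0 := by
      rw [← integral_inner_condExp (hm t) hg hgb hdi]
      refine integral_eq_zero_of_ae ?_
      filter_upwards [hmart t (Finset.mem_insert_self _ _)] with ω hω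
      rw [hω]
      simp
    have hii : Integrable (fun ω => inner ℝ (coshField B (∑ s ∈ S, d s ω)) (d t ω)) μ := by
      refine Integrable.of_bound ((hg.mono (hm t)).inner (hd t)).aestronglyMeasurable
        (Real.sinh (S.card * B) * Real.sinh B / B * B) ?_
      filter_upwards [hgb, hdB t] with ω h1 h2
      refine (norm_inner_le_norm _ _).trans ?_
      gcongr
    calc ∫ ω, Real.cosh ‖∑ s ∈ insert t S, d s ω‖ ∂μ
        ≤ ∫ ω, (Real.cosh ‖∑ s ∈ S, d s ω‖ * Real.cosh B +
            inner ℝ (coshField B (∑ s ∈ S, d s ω)) (d t ω)) ∂μ := by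
          refine integral_mono_ae (hint _) (((hint S).mul_const _).add hii) ?_
          filter_upwards [hdB t] with ω hω
          simp only [Finset.sum_insert htS]
          rw [add_comm]
          exact cosh_norm_add_le _ _ hω
      _ = (∫ ω, Real.cosh ‖∑ s ∈ S, d s ω‖ ∂μ) * Real.cosh B := by
          rw [integral_add ((hint S).mul_const _) hii, hzero, add_zero, integral_mul_const]
      _ ≤ Real.cosh B ^ S.card * Real.cosh B :=
          mul_le_mul_of_nonneg_right ih (Real.cosh_pos _).le
      _ = _ := by rw [Finset.card_insert_of_notMem htS, pow_succ]

theorem div_le_card_filter_mod_eq (n : ℕ) {L r : ℕ} (hL : 0 < L) (hr : r < L) :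
    n / L ≤ ((Finset.Icc 1 n).filter fun t => t % L = r).card := by
  let r' := if r = 0 then L else r
  have hr' : 1 ≤ r' ∧ r' ≤ L ∧ r' % L = r := by
    by_cases h : r = 0
    · simp [r', h]; omega
    · simp only [r', h, if_false]
      exact ⟨Nat.one_le_iff_ne_zero.2 h, hr.le, Nat.mod_eq_of_lt hr⟩
  have hinj : Set.InjOn (fun k => k * L + r') (Finset.range (n / L) : Set ℕ) := fun a _ b _ h => by
    simp only [Nat.add_right_cancel_iff] at h
    exact Nat.eq_of_mul_eq_mul_right hL h
  rw [← Finset.card_range (n / L), ← Finset.card_image_of_injOn hinj]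
  refine Finset.card_le_card fun t ht => ?_
  obtain ⟨k, hk, rfl⟩ := Finset.mem_image.1 ht
  have hk : k + 1 ≤ n / L := Finset.mem_range.1 hk
  have h1 : (k + 1) * L ≤ n := (Nat.mul_le_mul_right L hk).trans (Nat.div_mul_le_self n L)
  have h2 : (k + 1) * L = k * L + L := by ring
  refine Finset.mem_filter.2 ⟨Finset.mem_Icc.2 ⟨by omega, by omega⟩, ?_⟩
  rw [Nat.mul_add_mod_self_right]
  exact hr'.2.2

/-- Exponential inequality for an average of bounded Hilbert-valued variables, each of which is
centred given the variables that lie `L` or more steps in the past. The residue classes modulo `L`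
are martingales, and convexity of `cosh ‖·‖` averages over them without a union bound. -/
theorem measureReal_le_norm_average_le {n L : ℕ} (hL : 0 < L) (hLn : L ≤ n) (d : ℕ → Ω → G)
    (m : ℕ → MeasurableSpace Ω) (hm : ∀ t, m t ≤ m0) {B : ℝ} (hB : 0 < B)
    (hd : ∀ t, StronglyMeasurable (d t)) (hdB : ∀ t, ∀ᵐ ω ∂μ, ‖d t ω‖ ≤ B)
    (hadapt : ∀ s t, s + L ≤ t → StronglyMeasurable[m t] (d s))
    (hmart : ∀ t, μ[d t | m t] =ᵐ[μ] 0) {x : ℝ} (hx : 0 < x) :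
    μ.real {ω | x ≤ ‖(n : ℝ)⁻¹ • ∑ t ∈ Finset.Icc 1 n, d t ω‖} ≤
      2 * Real.exp (-(x ^ 2 * (n / L : ℕ) / (2 * B ^ 2))) := by
  have hn : (0 : ℝ) < n := by exact_mod_cast hL.trans_le hLn
  have hQ : (0 : ℝ) < (n / L : ℕ) := by exact_mod_cast Nat.div_pos hLn hL
  set Q : ℝ := ((n / L : ℕ) : ℝ) with hQ_def
  set l : ℝ := x * Q / B ^ 2 with hl
  have hl0 : 0 < l := by positivity
  let S : ℕ → Finset ℕ := fun r => (Finset.Icc 1 n).filter fun t => t % L = r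
  have hSQ : ∀ r ∈ Finset.range L, Q ≤ (S r).card := fun r hr => by
    exact Nat.cast_le.2 (div_le_card_filter_mod_eq n hL (Finset.mem_range.1 hr))
  have hmaps : ∀ t ∈ Finset.Icc 1 n, t % L ∈ Finset.range L := fun t _ =>
    Finset.mem_range.2 (Nat.mod_lt _ hL)
  have hcard : ∑ r ∈ Finset.range L, ((S r).card : ℝ) / n = 1 := by
    rw [← Finset.sum_div, ← Nat.cast_sum, ← Finset.card_eq_sum_card_fiberwise hmaps]
    simp [hn.ne']
  have hexp : ∀ r ∈ Finset.range L,
      ∫ ω, Real.cosh ‖∑ t ∈ S r, (l / (S r).card) • d t ω‖ ∂μ ≤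
        Real.exp (l ^ 2 * B ^ 2 / (2 * Q)) := by
    intro r hr
    have hc : 0 < ((S r).card : ℝ) := hQ.trans_le (hSQ r hr)
    have h := integral_cosh_norm_sum_le (μ := μ) (S r)
      (fun t ω => (l / (S r).card) • d t ω) m hm (B := l / (S r).card * B)
      (fun t => (hd t).const_smul _) (fun t => by
        filter_upwards [hdB t] with ω hω
        rw [norm_smul, Real.norm_of_nonneg (by positivity)]
        gcongr)
      (fun s hs t ht hst => by
        refine (hadapt s t ?_).const_smul _
        have h1 : s % L = r := (Finset.mem_filter.1 hs).2
        have h2 : t % L = r := (Finset.mem_filter.1 ht).2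
        have h3 : L ∣ t - s := (Nat.modEq_iff_dvd' hst.le).1 (h1.trans h2.symm)
        have := Nat.le_of_dvd (by omega) h3
        omega)
      (fun t _ => by
        filter_upwards [condExp_smul (μ := μ) (l / (S r).card) (d t) (m t), hmart t] with ω h1 h2
        have h1' : (μ[fun ω => (l / (S r).card : ℝ) • d t ω | m t]) ω =
          ((l / (S r).card : ℝ) • μ[d t | m t]) ω := h1
        rw [h1', Pi.smul_apply, h2, Pi.zero_apply, smul_zero])
    refine h.trans ((pow_le_pow_left₀ (Real.cosh_pos _).le (Real.cosh_le_exp_half_sq _) _).trans ?_)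
    rw [← Real.exp_nat_mul]
    refine Real.exp_le_exp.2 ?_
    have e : ((S r).card : ℝ) * ((l / (S r).card * B) ^ 2 / 2) =
        l ^ 2 * B ^ 2 / (2 * (S r).card) := by field_simp
    rw [e]
    gcongr
    exact hSQ r hr
  have hsm : ∀ (T : Finset ℕ) (a : ℝ), StronglyMeasurable fun ω => ∑ t ∈ T, a • d t ω := fun T a =>
    Finset.stronglyMeasurable_fun_sum _ fun t _ => (hd t).const_smul a
  have hint : ∀ (T : Finset ℕ) (a : ℝ), Integrable (fun ω => Real.cosh ‖∑ t ∈ T, a • d t ω‖) μ := by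
    intro T a
    refine Integrable.of_bound
      (Real.continuous_cosh.comp_stronglyMeasurable (hsm T a).norm).aestronglyMeasurable
      (Real.cosh (T.card * (|a| * B))) ?_
    filter_upwards [ae_all_iff.2 hdB] with ω hω
    rw [Real.norm_of_nonneg (Real.cosh_pos _).le, Real.cosh_le_cosh,
      abs_of_nonneg (norm_nonneg _), abs_of_nonneg (by positivity), ← nsmul_eq_mul]
    refine (norm_sum_le _ _).trans (Finset.sum_le_card_nsmul _ _ _ fun t _ => ?_)
    rw [norm_smul, Real.norm_eq_abs]
    gcongr
    exact hω t
  have hpt : ∀ ω, Real.cosh ‖∑ t ∈ Finset.Icc 1 n, (l / n) • d t ω‖ ≤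
      ∑ r ∈ Finset.range L, ((S r).card : ℝ) / n *
        Real.cosh ‖∑ t ∈ S r, (l / (S r).card) • d t ω‖ := by
    intro ω
    have h := (convexOn_cosh_norm (G := G)).map_sum_le (t := Finset.range L)
      (w := fun r => ((S r).card : ℝ) / n) (p := fun r => ∑ t ∈ S r, (l / (S r).card) • d t ω)
      (fun r _ => by positivity) hcard (fun r _ => Set.mem_univ _)
    have e : ∑ r ∈ Finset.range L, (((S r).card : ℝ) / n) •
        ∑ t ∈ S r, (l / (S r).card) • d t ω = ∑ t ∈ Finset.Icc 1 n, (l / n) • d t ω := by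
      rw [← Finset.sum_fiberwise_of_maps_to hmaps]
      refine Finset.sum_congr rfl fun r hr => ?_
      have hc : 0 < ((S r).card : ℝ) := hQ.trans_le (hSQ r hr)
      rw [Finset.smul_sum]
      refine Finset.sum_congr rfl fun t _ => ?_
      rw [smul_smul]
      congr 1
      field_simp
    simp only [e, smul_eq_mul] at h
    exact h
  have hE : ∫ ω, Real.cosh ‖∑ t ∈ Finset.Icc 1 n, (l / n) • d t ω‖ ∂μ ≤
      Real.exp (l ^ 2 * B ^ 2 / (2 * Q)) := by
    calc _ ≤ ∫ ω, ∑ r ∈ Finset.range L, ((S r).card : ℝ) / n *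
          Real.cosh ‖∑ t ∈ S r, (l / (S r).card) • d t ω‖ ∂μ :=
          integral_mono (hint _ _) (integrable_finsetSum _ fun r _ => (hint _ _).const_mul _) hpt
      _ = ∑ r ∈ Finset.range L, ((S r).card : ℝ) / n *
          ∫ ω, Real.cosh ‖∑ t ∈ S r, (l / (S r).card) • d t ω‖ ∂μ := by
          rw [integral_finsetSum _ fun r _ => (hint _ _).const_mul _]
          simp only [integral_const_mul]
      _ ≤ ∑ r ∈ Finset.range L, ((S r).card : ℝ) / n * Real.exp (l ^ 2 * B ^ 2 / (2 * Q)) := by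
          refine Finset.sum_le_sum fun r hr => ?_
          gcongr
          exact hexp r hr
      _ = _ := by rw [← Finset.sum_mul, hcard, one_mul]
  have hmarkov := mul_meas_ge_le_integral_of_nonneg
    (ae_of_all μ fun ω => (Real.cosh_pos ‖∑ t ∈ Finset.Icc 1 n, (l / n) • d t ω‖).le)
    (hint _ _) (Real.cosh (l * x))
  have hset : {ω | x ≤ ‖(n : ℝ)⁻¹ • ∑ t ∈ Finset.Icc 1 n, d t ω‖} ⊆
      {ω | Real.cosh (l * x) ≤ Real.cosh ‖∑ t ∈ Finset.Icc 1 n, (l / n) • d t ω‖} := by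
    intro ω hω
    have hω : x ≤ ‖(n : ℝ)⁻¹ • ∑ t ∈ Finset.Icc 1 n, d t ω‖ := hω
    have e : ∑ t ∈ Finset.Icc 1 n, (l / n) • d t ω =
        l • (n : ℝ)⁻¹ • ∑ t ∈ Finset.Icc 1 n, d t ω := by
      rw [smul_smul, Finset.smul_sum, div_eq_mul_inv]
    rw [Set.mem_ofPred_eq, e, norm_smul, Real.norm_of_nonneg hl0.le, Real.cosh_le_cosh,
      abs_of_nonneg (by positivity), abs_of_nonneg (by positivity)]
    gcongr
  have hP := measureReal_mono (μ := μ) hset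
  have hcosh : Real.exp (l * x) / 2 ≤ Real.cosh (l * x) := by
    rw [Real.cosh_eq]
    have := Real.exp_pos (-(l * x))
    linarith
  set P := μ.real {ω | x ≤ ‖(n : ℝ)⁻¹ • ∑ t ∈ Finset.Icc 1 n, d t ω‖} with hP_def
  have hP0 : 0 ≤ P := measureReal_nonneg
  have h1 : Real.exp (l * x) / 2 * P ≤ Real.exp (l ^ 2 * B ^ 2 / (2 * Q)) := by
    calc _ ≤ Real.cosh (l * x) * μ.real {ω | Real.cosh (l * x) ≤
          Real.cosh ‖∑ t ∈ Finset.Icc 1 n, (l / n) • d t ω‖} := by gcongr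
      _ ≤ _ := hmarkov
      _ ≤ _ := hE
  have h2 : P ≤ 2 * (Real.exp (l ^ 2 * B ^ 2 / (2 * Q)) * Real.exp (-(l * x))) := by
    have h3 := mul_le_mul_of_nonneg_right h1 (Real.exp_pos (-(l * x))).le
    have h4 : Real.exp (l * x) * Real.exp (-(l * x)) = 1 := by rw [← Real.exp_add]; simp
    have h5 : Real.exp (l * x) / 2 * P * Real.exp (-(l * x)) = P / 2 := by
      linear_combination (P / 2) * h4
    rw [h5] at h3
    linarith
  refine h2.trans (le_of_eq ?_)
  rw [← Real.exp_add]
  congr 2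
  rw [hl]
  field_simp
  ring

end Pinelis

/-! ### Stationary processes -/

section Stationary

open ProbabilityTheory

variable {Ω : Type*} {E : Type*} [MeasurableSpace E] {X Y : ℤ → Ω → E}

theorem sigmaField_mono {I J : Set ℤ} (h : I ⊆ J) : sigmaField X I ≤ sigmaField X J :=
  iSup₂_le fun t ht => le_iSup₂_of_le t (h ht) le_rfl

theorem measurable_sigmaField {I : Set ℤ} {t : ℤ} (ht : t ∈ I) :
    Measurable[sigmaField X I] (X t) :=
  (comap_measurable (X t)).mono (le_iSup₂_of_le t ht le_rfl) le_rfl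

theorem sigmaField_shift_Iic (X : ℤ → Ω → E) (s a : ℤ) :
    sigmaField (fun t => X (t + s)) (Set.Iic a) = sigmaField X (Set.Iic (a + s)) := by
  refine le_antisymm (iSup₂_le fun t ht => ?_) (iSup₂_le fun t ht => ?_)
  · exact le_iSup₂_of_le (t + s) (add_le_add_left (Set.mem_Iic.1 ht) s) le_rfl
  · refine le_iSup₂_of_le (t - s) (Set.mem_Iic.2 (sub_le_iff_le_add.2 (Set.mem_Iic.1 ht))) ?_
    simp only [sub_add_cancel, le_refl]

theorem sigmaField_shift_Ici (X : ℤ → Ω → E) (s a : ℤ) :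
    sigmaField (fun t => X (t + s)) (Set.Ici a) = sigmaField X (Set.Ici (a + s)) := by
  refine le_antisymm (iSup₂_le fun t ht => ?_) (iSup₂_le fun t ht => ?_)
  · exact le_iSup₂_of_le (t + s) (add_le_add_left (Set.mem_Ici.1 ht) s) le_rfl
  · refine le_iSup₂_of_le (t - s) (Set.mem_Ici.2 (le_sub_iff_add_le.2 (Set.mem_Ici.1 ht))) ?_
    simp only [sub_add_cancel, le_refl]

theorem sigmaField_eq_comap (X : ℤ → Ω → E) (I : Set ℤ) :
    sigmaField X I =
      (sigmaField (fun (t : ℤ) (x : ℤ → E) => x t) I).comap (fun ω t => X t ω) := by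
  simp only [sigmaField, MeasurableSpace.comap_iSup, MeasurableSpace.comap_comp]
  rfl

variable [m0 : MeasurableSpace Ω] {μ : Measure Ω}

theorem sigmaField_le (hX : ∀ t, Measurable (X t)) (I : Set ℤ) : sigmaField X I ≤ m0 :=
  iSup₂_le fun t _ => (hX t).comap_le

/-- The mixing coefficient between parts of a process depends on the law of the process only. -/
theorem alphaCoeff_sigmaField_le_of_map_eq [IsProbabilityMeasure μ] (hX : ∀ t, Measurable (X t))
    (hY : ∀ t, Measurable (Y t))
    (h : μ.map (fun ω t => X t ω) = μ.map (fun ω t => Y t ω)) (I J : Set ℤ) :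
    alphaCoeff μ (sigmaField X I) (sigmaField X J) ≤
      alphaCoeff μ (sigmaField Y I) (sigmaField Y J) := by
  have hX' : Measurable fun ω t => X t ω := measurable_pi_lambda _ hX
  have hY' : Measurable fun ω t => Y t ω := measurable_pi_lambda _ hY
  refine csSup_le ⟨_, ∅, ∅, @MeasurableSet.empty _ (_), @MeasurableSet.empty _ (_), rfl⟩ ?_
  rintro _ ⟨A, B, hA, hB, rfl⟩
  rw [sigmaField_eq_comap] at hA hB
  obtain ⟨A', hA', rfl⟩ := hA
  obtain ⟨B', hB', rfl⟩ := hB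
  have hle : ∀ K : Set ℤ, sigmaField (fun (t : ℤ) (x : ℤ → E) => x t) K ≤ MeasurableSpace.pi :=
    sigmaField_le measurable_pi_apply
  have hreal : ∀ C : Set (ℤ → E), MeasurableSet C →
      μ.real ((fun ω t => X t ω) ⁻¹' C) = μ.real ((fun ω t => Y t ω) ⁻¹' C) := fun C hC => by
    rw [← map_measureReal_apply hX' hC, ← map_measureReal_apply hY' hC, h]
  rw [← Set.preimage_inter, hreal _ (hle _ _ hA'), hreal _ (hle _ _ hB'),
    hreal _ ((hle _ _ hA').inter (hle _ _ hB')), Set.preimage_inter]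
  refine abs_measureReal_inter_sub_mul_le_alphaCoeff ?_ ?_
  · rw [sigmaField_eq_comap]; exact ⟨A', hA', rfl⟩
  · rw [sigmaField_eq_comap]; exact ⟨B', hB', rfl⟩

theorem IsStationarySeq.map_shift [IsFiniteMeasure μ] (h : IsStationarySeq μ X)
    (hX : ∀ t, Measurable (X t)) (s : ℕ) :
    μ.map (fun ω t => X t ω) = μ.map (fun ω t => X (t + s) ω) := by
  rw [map_eq_iff_forall_finset_map_restrict_eq
    (measurable_pi_lambda _ hX).aemeasurable
    (measurable_pi_lambda _ fun t => hX (t + s)).aemeasurable]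
  intro I
  have hr : Measurable fun (f : Fin I.card → E) (i : I) => f (I.equivFin i) :=
    measurable_pi_lambda _ fun i => measurable_pi_apply _
  have e : ∀ Y : ℤ → Ω → E, (∀ t, Measurable (Y t)) → μ.map (fun ω => I.restrict (Y · ω)) =
      (μ.map fun ω i => Y (I.equivFin.symm i) ω).map
        fun (f : Fin I.card → E) (i : I) => f (I.equivFin i) := by
    intro Y hY
    rw [Measure.map_map hr (measurable_pi_lambda _ fun i => hY _)]
    congr 1
    ext ω i
    simp
  rw [e X hX, e (fun t => X (t + s)) fun t => hX (t + s)]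
  exact congrArg _ (h I.card (fun i => I.equivFin.symm i) s)

/-- By stationarity, the mixing coefficient between past and future does not depend on the time at
which the past ends. -/
theorem IsStationarySeq.alphaCoeff_le_alphaMix [IsProbabilityMeasure μ] (h : IsStationarySeq μ X)
    (hX : ∀ t, Measurable (X t)) {a b M : ℤ} (hab : a + M ≤ b) :
    alphaCoeff μ (sigmaField X (Set.Iic a)) (sigmaField X (Set.Ici b)) ≤ alphaMix μ X M := by
  have key : alphaCoeff μ (sigmaField X (Set.Iic a)) (sigmaField X (Set.Ici (a + M))) ≤
      alphaMix μ X M := by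
    rcases le_total 0 a with ha | ha
    · have := alphaCoeff_sigmaField_le_of_map_eq (fun t => hX (t + (a.toNat : ℤ))) hX
        (h.map_shift hX a.toNat).symm (Set.Iic 0) (Set.Ici M)
      rwa [sigmaField_shift_Iic, sigmaField_shift_Ici, Int.toNat_of_nonneg ha, zero_add,
        add_comm] at this
    · have := alphaCoeff_sigmaField_le_of_map_eq hX (fun t => hX (t + ((-a).toNat : ℤ)))
        (h.map_shift hX (-a).toNat) (Set.Iic a) (Set.Ici (a + M))
      rwa [sigmaField_shift_Iic, sigmaField_shift_Ici, Int.toNat_of_nonneg (by omega),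
        add_neg_cancel, show a + M + -a = M by ring] at this
  refine le_trans (csSup_le ⟨_, ∅, ∅, @MeasurableSet.empty _ (_), @MeasurableSet.empty _ (_), rfl⟩
    ?_) key
  rintro _ ⟨A, B, hA, hB, rfl⟩
  exact abs_measureReal_inter_sub_mul_le_alphaCoeff hA
    (sigmaField_mono (Set.Ici_subset_Ici.2 hab) _ hB)

end Stationary

/-! ### Eigenvalues of covariance operators -/

section TraceClass

variable {F : Type*} [NormedAddCommGroup F] [InnerProductSpace ℝ F]

theorem eigenvalueSeq_nonneg (T : F →L[ℝ] F) (j : ℕ) : 0 ≤ eigenvalueSeq T j :=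
  Real.sSup_nonneg fun _ ht => ht.1.le

theorem mul_norm_sq_le_inner_of_mem_iSup_eigenspace {T : F →ₗ[ℝ] F} (hT : T.IsSymmetric) {t : ℝ}
    {v : F} (hv : v ∈ ⨆ s ∈ Set.Ici t, Module.End.eigenspace T s) :
    t * ‖v‖ ^ 2 ≤ inner ℝ (T v) v := by
  rw [iSup_subtype'] at hv
  obtain ⟨f, hf, rfl⟩ := (Submodule.mem_iSup_iff_exists_finsupp _ _).1 hv
  have horth : ∀ i j, i ≠ j → inner ℝ (f i) (f j) = 0 := fun i j hij =>
    hT.orthogonalFamily_eigenspaces (i := (i : ℝ)) (j := j)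
      (fun h => hij (Subtype.ext h)) ⟨f i, hf i⟩ ⟨f j, hf j⟩
  have hTf : ∀ i, T (f i) = (i : ℝ) • f i := fun i => Module.End.mem_eigenspace_iff.1 (hf i)
  have e1 : ∀ i ∈ f.support, inner ℝ (f i) (∑ j ∈ f.support, f j) = ‖f i‖ ^ 2 := by
    intro i hi
    rw [inner_sum, Finset.sum_eq_single_of_mem i hi fun j _ hj => horth i j hj.symm,
      real_inner_self_eq_norm_sq]
  rw [Finsupp.sum, ← real_inner_self_eq_norm_sq, map_sum, sum_inner, sum_inner, Finset.mul_sum]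
  refine Finset.sum_le_sum fun i hi => ?_
  rw [hTf, inner_smul_left, RCLike.conj_to_real, e1 i hi]
  exact mul_le_mul_of_nonneg_right i.2 (sq_nonneg _)

/-- A subspace of dimension larger than the cardinality of `s` contains a unit vector orthogonal
to `s`. -/
theorem exists_norm_eq_one_orthogonal (V : Submodule ℝ F) (s : Finset F)
    (h : (s.card : Cardinal) < Module.rank ℝ V) :
    ∃ v ∈ V, ‖v‖ = 1 ∧ ∀ w ∈ s, inner ℝ w v = 0 := by
  let L : V →ₗ[ℝ] (s → ℝ) := LinearMap.pi fun w => (innerₛₗ ℝ (w : F)).comp V.subtype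
  have hL : ¬ Function.Injective L := fun hi => by
    have h1 := LinearMap.lift_rank_le_of_injective L hi
    rw [rank_fun'] at h1
    exact absurd h (not_lt.2 (by simpa using h1))
  rw [← LinearMap.ker_eq_bot, Submodule.eq_bot_iff] at hL
  push Not at hL
  obtain ⟨x, hx, hx0⟩ := hL
  have hx0' : ‖(x : F)‖ ≠ 0 := by simpa using hx0
  refine ⟨‖(x : F)‖⁻¹ • (x : F), V.smul_mem _ x.2, ?_, fun w hw => ?_⟩
  · rw [norm_smul, norm_inv, norm_norm, inv_mul_cancel₀ hx0']
  · have : inner ℝ w (x : F) = 0 := congrFun (LinearMap.mem_ker.1 hx) ⟨w, hw⟩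
    rw [inner_smul_right, this, mul_zero]

/-- If the quadratic form of a symmetric operator sums to at most `c` over every finite orthonormal
set, then so do its positive eigenvalues. -/
theorem summable_eigenvalueSeq {T : F →L[ℝ] F}
    (hT : (T : F →ₗ[ℝ] F).IsSymmetric) {c : ℝ}
    (hc : ∀ s : Finset F, Orthonormal ℝ (fun v : s => (v : F)) → ∑ v ∈ s, inner ℝ (T v) v ≤ c) :
    Summable (eigenvalueSeq T) := by
  classical
  have greedy : ∀ (e : ℝ), 0 < e → ∀ J : ℕ, ∃ s : Finset F, s.card ≤ J ∧
      Orthonormal ℝ (fun v : s => (v : F)) ∧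
      ∑ j ∈ Finset.range J, (eigenvalueSeq T j - e) ≤ ∑ v ∈ s, inner ℝ (T v) v := by
    intro e he J
    induction J with
    | zero => exact ⟨∅, by simp, ⟨fun i => absurd i.2 (Finset.notMem_empty _),
        fun i => absurd i.2 (Finset.notMem_empty _)⟩,
        by simp⟩
    | succ J ih =>
      obtain ⟨s, hs, hon, hsum⟩ := ih
      rcases (eigenvalueSeq_nonneg T J).eq_or_lt with h0 | hpos
      · refine ⟨s, by omega, hon, ?_⟩
        rw [Finset.sum_range_succ]
        linarith
      -- a level `t` just below the eigenvalue, with an eigenspace sum of dimension larger than `J`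
      have hne : {t : ℝ | 0 < t ∧ (J : Cardinal) < Module.rank ℝ (⨆ s ∈ Set.Ici t,
          Module.End.eigenspace (T : F →ₗ[ℝ] F) s : Submodule ℝ F)}.Nonempty := by
        by_contra hne
        rw [Set.not_nonempty_iff_eq_empty] at hne
        rw [eigenvalueSeq, hne, Real.sSup_empty] at hpos
        exact lt_irrefl _ hpos
      obtain ⟨t, ⟨-, ht⟩, hte⟩ := exists_lt_of_lt_csSup hne
        (show eigenvalueSeq T J - e < _ from sub_lt_self _ he)
      obtain ⟨v, hv, hv1, hvs⟩ := exists_norm_eq_one_orthogonal _ s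
        ((Nat.cast_le.2 hs).trans_lt ht)
      have hvn : v ∉ s := fun h => by
        have := hvs v h
        rw [real_inner_self_eq_norm_sq, hv1] at this
        norm_num at this
      have hin := mul_norm_sq_le_inner_of_mem_iSup_eigenspace hT hv
      rw [hv1, one_pow, mul_one] at hin
      refine ⟨insert v s, by rw [Finset.card_insert_of_notMem hvn]; omega, ⟨?_, ?_⟩, ?_⟩
      · rintro ⟨w, hw⟩
        rcases Finset.mem_insert.1 hw with rfl | hw
        · exact hv1
        · exact hon.1 ⟨w, hw⟩
      · rintro ⟨w, hw⟩ ⟨w', hw'⟩ hne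
        have hne : w ≠ w' := fun h => hne (Subtype.ext h)
        change inner ℝ w w' = 0
        rcases Finset.mem_insert.1 hw with h | h <;> rcases Finset.mem_insert.1 hw' with h' | h'
        · exact absurd (h.trans h'.symm) hne
        · rw [h, real_inner_comm]; exact hvs w' h'
        · rw [h']; exact hvs w h
        · exact hon.2 (i := ⟨w, h⟩) (j := ⟨w', h'⟩) fun h => hne (congrArg Subtype.val h)
      · rw [Finset.sum_range_succ, Finset.sum_insert hvn]
        have : inner ℝ ((T : F →ₗ[ℝ] F) v) v = inner ℝ (T v) v := rfl
        linarith
  refine summable_of_sum_range_le (c := c) (eigenvalueSeq_nonneg T) fun J => ?_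
  refine le_of_forall_pos_le_add fun e he => ?_
  obtain ⟨s, -, hon, hsum⟩ := greedy (e / (J + 1)) (by positivity) J
  have h1 := hsum.trans (hc s hon)
  rw [Finset.sum_sub_distrib, Finset.sum_const, Finset.card_range, nsmul_eq_mul] at h1
  have h2 : (J : ℝ) * (e / (J + 1)) ≤ e := by
    rw [mul_div_assoc', div_le_iff₀ (by positivity)]
    nlinarith
  linarith

variable [CompleteSpace F] {Ω : Type*} [MeasurableSpace Ω] {μ : Measure Ω}
  [IsProbabilityMeasure μ]

/-- The covariance operator of a bounded Hilbert-valued variable `W` has trace at most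
`sup ‖W‖ ^ 2`. -/
theorem summable_eigenvalueSeq_integral_rankOne {W : Ω → F} {a : ℝ} (hW : StronglyMeasurable W)
    (hWa : ∀ ω, ‖W ω‖ ≤ a) :
    Summable (eigenvalueSeq (∫ ω, InnerProductSpace.rankOne ℝ (W ω) (W ω) ∂μ)) := by
  have hi : Integrable (fun ω => InnerProductSpace.rankOne ℝ (W ω) (W ω)) μ := by
    refine Integrable.of_bound (C := a * a) ?_ (ae_of_all _ fun ω => ?_)
    · have hcont : Continuous fun x : F => InnerProductSpace.rankOne ℝ x x :=
        (InnerProductSpace.rankOne ℝ).continuous.clm_apply continuous_id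
      exact (hcont.comp_stronglyMeasurable hW).aestronglyMeasurable
    · rw [InnerProductSpace.norm_rankOne]
      exact mul_le_mul (hWa ω) (hWa ω) (norm_nonneg _) ((norm_nonneg _).trans (hWa ω))
  have hin : ∀ x y, inner ℝ ((∫ ω, InnerProductSpace.rankOne ℝ (W ω) (W ω) ∂μ) x) y =
      ∫ ω, inner ℝ (W ω) x * inner ℝ (W ω) y ∂μ := by
    intro x y
    rw [ContinuousLinearMap.integral_apply hi, real_inner_comm,
      ← integral_inner (hi.apply_continuousLinearMap x)]
    refine integral_congr_ae (ae_of_all _ fun ω => ?_)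
    simp only [InnerProductSpace.rankOne_apply, inner_smul_right]
    rw [real_inner_comm y]
  refine summable_eigenvalueSeq (c := a ^ 2) (fun x y => ?_) fun s hs => ?_
  · simp only [ContinuousLinearMap.coe_coe]
    rw [hin, real_inner_comm, hin]
    simp only [mul_comm]
  · simp only [hin]
    have hint : ∀ v ∈ s, Integrable (fun ω => inner ℝ (W ω) v * inner ℝ (W ω) v) μ := by
      intro v _
      refine Integrable.of_bound (C := (a * ‖v‖) * (a * ‖v‖))
        ((hW.inner stronglyMeasurable_const).mul
          (hW.inner stronglyMeasurable_const)).aestronglyMeasurable (ae_of_all _ fun ω => ?_)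
      have : ‖inner ℝ (W ω) v‖ ≤ a * ‖v‖ :=
        (norm_inner_le_norm _ _).trans (mul_le_mul_of_nonneg_right (hWa ω) (norm_nonneg _))
      rw [norm_mul]
      exact mul_le_mul this this (norm_nonneg _) ((norm_nonneg _).trans this)
    rw [← integral_finsetSum _ hint]
    calc _ ≤ ∫ _, a ^ 2 ∂μ := by
          refine integral_mono (integrable_finsetSum _ hint) (integrable_const _) fun ω => ?_
          have h1 := hs.sum_inner_products_le (s := Finset.univ) (x := W ω)
          simp only [Real.norm_eq_abs, sq_abs] at h1
          rw [Finset.sum_coe_sort s fun v => inner ℝ v (W ω) ^ 2] at h1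
          simp only [← pow_two, real_inner_comm] at h1 ⊢
          exact h1.trans (pow_le_pow_left₀ (norm_nonneg _) (hWa ω) 2)
      _ = a ^ 2 := by simp

end TraceClass

/-! ### Hilbert–Schmidt tensors and the conditional bias -/

section HilbertSchmidtTensor

variable {H : Type*} [NormedAddCommGroup H] [InnerProductSpace ℝ H] [CompleteSpace H]

theorem toCLM_hsTensor (x y z : H) : (hsTensor x y).toCLM z = inner ℝ y z • x := rfl

theorem inner_hsTensor (A : HSOp H) (x y : H) :
    inner ℝ A (hsTensor x y) = inner ℝ (A.toCLM y) x := by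
  have h1 : inner ℝ A (hsTensor x y) =
      ∑' i, inner ℝ (A.toCLM (hsBasis H i)) ((hsTensor x y).toCLM (hsBasis H i)) :=
    lp.inner_eq_tsum (HSOp.toLp H A) (HSOp.toLp H (hsTensor x y))
  rw [h1, ← ContinuousLinearMap.adjoint_inner_right,
    ← (hsBasis H).tsum_inner_mul_inner y]
  refine tsum_congr fun i => ?_
  rw [toCLM_hsTensor, inner_smul_right, ContinuousLinearMap.adjoint_inner_right]

theorem norm_hsTensor (x y : H) : ‖hsTensor x y‖ = ‖x‖ * ‖y‖ := by
  rw [← sq_eq_sq₀ (norm_nonneg _) (by positivity), ← real_inner_self_eq_norm_sq, inner_hsTensor,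
    toCLM_hsTensor, inner_smul_left, RCLike.conj_to_real, real_inner_self_eq_norm_sq,
    real_inner_self_eq_norm_sq]
  ring

theorem norm_toCLM_apply_le (A : HSOp H) (y : H) : ‖A.toCLM y‖ ≤ ‖A‖ * ‖y‖ := by
  rcases (norm_nonneg (A.toCLM y)).eq_or_lt with h | h
  · rw [← h]; positivity
  have h1 : inner ℝ (A.toCLM y) (A.toCLM y) ≤ ‖A‖ * (‖A.toCLM y‖ * ‖y‖) := by
    rw [← inner_hsTensor, ← norm_hsTensor]
    exact real_inner_le_norm _ _
  rw [real_inner_self_eq_norm_sq] at h1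
  exact le_of_mul_le_mul_left (by linarith) h

/-- Evaluation of Hilbert–Schmidt operators, as a continuous bilinear map. -/
noncomputable def hsEval : HSOp H →L[ℝ] H →L[ℝ] H :=
  LinearMap.mkContinuous₂
    (LinearMap.mk₂ ℝ (fun (A : HSOp H) (y : H) => A.toCLM y) (fun _ _ _ => rfl) (fun _ _ _ => rfl)
      (fun A y z => map_add A.toCLM y z) (fun r A y => map_smul A.toCLM r y))
    1 fun A y => by rw [one_mul]; exact norm_toCLM_apply_le A y

/-- The tensor `x ⊗ y`, as a continuous bilinear map. -/
noncomputable def hsTensorCLM : H →L[ℝ] H →L[ℝ] HSOp H :=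
  LinearMap.mkContinuous₂
    (LinearMap.mk₂ ℝ (hsTensor : H → H → HSOp H)
      (fun x x' y => Subtype.ext (by
        change InnerProductSpace.rankOne ℝ (x + x') y =
          InnerProductSpace.rankOne ℝ x y + InnerProductSpace.rankOne ℝ x' y
        simp))
      (fun r x y => Subtype.ext (by
        change InnerProductSpace.rankOne ℝ (r • x) y = r • InnerProductSpace.rankOne ℝ x y
        simp))
      (fun x y y' => Subtype.ext (by
        change InnerProductSpace.rankOne ℝ x (y + y') =
          InnerProductSpace.rankOne ℝ x y + InnerProductSpace.rankOne ℝ x y'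
        simp))
      (fun r x y => Subtype.ext (by
        change InnerProductSpace.rankOne ℝ x (r • y) = r • InnerProductSpace.rankOne ℝ x y
        simp)))
    1 fun x y => by rw [one_mul]; exact (norm_hsTensor x y).le

variable {Ω : Type*} {m : MeasurableSpace Ω}

theorem stronglyMeasurable_hsTensor {f g : Ω → H} (hf : StronglyMeasurable[m] f)
    (hg : StronglyMeasurable[m] g) : StronglyMeasurable[m] fun ω => hsTensor (f ω) (g ω) :=
  hsTensorCLM.continuous₂.comp_stronglyMeasurable (hf.prodMk hg)

theorem stronglyMeasurable_toCLM_apply {f : Ω → HSOp H} {g : Ω → H}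
    (hf : StronglyMeasurable[m] f) (hg : StronglyMeasurable[m] g) :
    StronglyMeasurable[m] fun ω => (f ω).toCLM (g ω) :=
  hsEval.continuous₂.comp_stronglyMeasurable (hf.prodMk hg)

end HilbertSchmidtTensor

section ConditionalBias

variable {G : Type*} [NormedAddCommGroup G] [InnerProductSpace ℝ G] [CompleteSpace G]
  {Ω : Type*} {m₁ : MeasurableSpace Ω} [m0 : MeasurableSpace Ω] {μ : Measure Ω}
  [IsProbabilityMeasure μ]

/-- The `L¹` norm of a conditional expectation, by duality. -/
theorem integral_norm_condExp_sub_le (hm : m₁ ≤ m0) {y : Ω → G} (hy : Integrable y μ) {C : G}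
    {K : ℝ} (hK : ∀ g : Ω → G, StronglyMeasurable[m₁] g → (∀ ω, ‖g ω‖ ≤ 1) →
      ∫ ω, inner ℝ (g ω) (y ω) ∂μ - inner ℝ (∫ ω, g ω ∂μ) C ≤ K) :
    ∫ ω, ‖(μ[y | m₁]) ω - C‖ ∂μ ≤ K := by
  have hD : StronglyMeasurable[m₁] fun ω => (μ[y | m₁]) ω - C :=
    stronglyMeasurable_condExp.sub stronglyMeasurable_const
  let g : Ω → G := fun ω => ‖(μ[y | m₁]) ω - C‖⁻¹ • ((μ[y | m₁]) ω - C)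
  have hg : StronglyMeasurable[m₁] g := by
    refine StronglyMeasurable.smul ?_ hD
    exact (hD.norm.measurable.inv).stronglyMeasurable
  have hg1 : ∀ ω, ‖g ω‖ ≤ 1 := fun ω => by
    simp only [g, norm_smul, norm_inv, norm_norm]
    exact inv_mul_le_one
  have hgi : Integrable g μ := (memLp_of_norm_le hm hg hg1).integrable le_rfl
  have hgm := (hg.mono hm).aestronglyMeasurable (μ := μ)
  have hi : Integrable (fun ω => inner ℝ (g ω) ((μ[y | m₁]) ω)) μ := by
    refine (integrable_condExp (f := y) (m := m₁) (μ := μ)).norm.mono'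
      (hgm.inner integrable_condExp.1) (ae_of_all _ fun ω => ?_)
    exact (norm_inner_le_norm _ _).trans
      (mul_le_of_le_one_left (norm_nonneg _) (hg1 ω))
  have hpt : ∀ ω, ‖(μ[y | m₁]) ω - C‖ =
      inner ℝ (g ω) ((μ[y | m₁]) ω) - inner ℝ C (g ω) := by
    intro ω
    rw [real_inner_comm (g ω) C, ← inner_sub_right]
    simp only [g, inner_smul_left, RCLike.conj_to_real, real_inner_self_eq_norm_sq]
    rcases eq_or_ne ‖(μ[y | m₁]) ω - C‖ 0 with h | h
    · rw [h]; simp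
    · field_simp
  calc ∫ ω, ‖(μ[y | m₁]) ω - C‖ ∂μ
      = ∫ ω, inner ℝ (g ω) (y ω) ∂μ - inner ℝ (∫ ω, g ω ∂μ) C := by
        simp only [hpt]
        rw [integral_sub hi (hgi.const_inner C), integral_inner hgi, real_inner_comm C,
          integral_inner_condExp hm hg (ae_of_all _ hg1) hy]
    _ ≤ K := hK g hg hg1

theorem norm_condExp_le_of_norm_le {y : Ω → G} {a : ℝ} (hm : m₁ ≤ m0) (hy : Integrable y μ)
    (ha : ∀ ω, ‖y ω‖ ≤ a) : ∀ᵐ ω ∂μ, ‖(μ[y | m₁]) ω‖ ≤ a := by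
  have h2 := condExp_mono (m := m₁) hy.norm (integrable_const a) (ae_of_all μ ha)
  rw [condExp_const hm] at h2
  filter_upwards [norm_condExp_le (m := m₁) (μ := μ) y, h2] with ω h1 h2 using h1.trans h2

/-- Deviation of an average of bounded Hilbert-valued variables `y t` from a vector `C`: the
fluctuation around the conditional means given the past is handled by the martingale inequality, the
remaining bias in `L¹`. -/
theorem measureReal_lt_norm_average_sub_le {n L : ℕ} (hL : 0 < L) (hLn : L ≤ n) (y : ℕ → Ω → G)
    (C : G) (m : ℕ → MeasurableSpace Ω) (hm : ∀ t, m t ≤ m0) {c K : ℝ} (hc : 0 < c)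
    (hy : ∀ t, StronglyMeasurable (y t)) (hyc : ∀ t ω, ‖y t ω‖ ≤ c)
    (hadapt : ∀ s t, s + L ≤ t → StronglyMeasurable[m t] (y s))
    (hmono : ∀ s t, s ≤ t → m s ≤ m t)
    (hK : ∀ t, ∫ ω, ‖(μ[y t | m t]) ω - C‖ ∂μ ≤ K) {ε : ℝ} (hε : 0 < ε) :
    μ.real {ω | ε < ‖(n : ℝ)⁻¹ • ∑ t ∈ Finset.Icc 1 n, y t ω - C‖} ≤
      2 * Real.exp (-(ε ^ 2 * (n / L : ℕ) / (32 * c ^ 2))) + 2 * K / ε := by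
  have hn : (0 : ℝ) < n := by exact_mod_cast hL.trans_le hLn
  have hyi : ∀ t, Integrable (y t) μ := fun t =>
    Integrable.of_bound (hy t).aestronglyMeasurable c (ae_of_all _ (hyc t))
  let d : ℕ → Ω → G := fun t ω => y t ω - (μ[y t | m t]) ω
  let D : ℕ → Ω → G := fun t ω => (μ[y t | m t]) ω - C
  have hDi : ∀ t, Integrable (D t) μ := fun t => integrable_condExp.sub (integrable_const _)
  have hmart := measureReal_le_norm_average_le (μ := μ) hL hLn d m hm (B := 2 * c) (by positivity)
    (fun t => (hy t).sub (stronglyMeasurable_condExp.mono (hm t)))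
    (fun t => by
      filter_upwards [norm_condExp_le_of_norm_le (hm t) (hyi t) (hyc t)] with ω hω
      have := norm_sub_le (y t ω) ((μ[y t | m t]) ω)
      have := hyc t ω
      simp only [d]
      linarith)
    (fun s t hst => (hadapt s t hst).sub
      (stronglyMeasurable_condExp.mono (hmono s t (by omega))))
    (fun t => by
      have h1 := condExp_sub (hyi t) (integrable_condExp (μ := μ) (m := m t) (f := y t)) (m t)
      have h2 : μ[μ[y t | m t] | m t] = μ[y t | m t] :=
        condExp_of_stronglyMeasurable (hm t) stronglyMeasurable_condExp integrable_condExp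
      rw [h2, sub_self] at h1
      exact h1)
    (half_pos hε)
  have hbias : μ.real {ω | ε / 2 ≤ ‖(n : ℝ)⁻¹ • ∑ t ∈ Finset.Icc 1 n, D t ω‖} ≤ 2 * K / ε := by
    have hi : Integrable (fun ω => ‖(n : ℝ)⁻¹ • ∑ t ∈ Finset.Icc 1 n, D t ω‖) μ :=
      ((integrable_finsetSum _ fun t _ => hDi t).smul (n : ℝ)⁻¹).norm
    have h1 := mul_meas_ge_le_integral_of_nonneg (ae_of_all μ fun ω => norm_nonneg _) hi (ε / 2)
    have h2 : ∫ ω, ‖(n : ℝ)⁻¹ • ∑ t ∈ Finset.Icc 1 n, D t ω‖ ∂μ ≤ K := by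
      calc _ ≤ ∫ ω, (n : ℝ)⁻¹ * ∑ t ∈ Finset.Icc 1 n, ‖D t ω‖ ∂μ := by
            refine integral_mono hi ((integrable_finsetSum _ fun t _ => (hDi t).norm).const_mul _)
              fun ω => ?_
            simp only [norm_smul, norm_inv, Real.norm_natCast]
            gcongr
            exact norm_sum_le _ _
        _ = (n : ℝ)⁻¹ * ∑ t ∈ Finset.Icc 1 n, ∫ ω, ‖D t ω‖ ∂μ := by
            rw [integral_const_mul, integral_finsetSum _ fun t _ => (hDi t).norm]
        _ ≤ (n : ℝ)⁻¹ * ∑ _t ∈ Finset.Icc 1 n, K := by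
            gcongr with t
            exact hK t
        _ = K := by
            rw [Finset.sum_const, Nat.card_Icc, Nat.add_sub_cancel, nsmul_eq_mul,
              inv_mul_cancel_left₀ hn.ne']
    rw [le_div_iff₀ hε]
    linarith
  have hset : {ω | ε < ‖(n : ℝ)⁻¹ • ∑ t ∈ Finset.Icc 1 n, y t ω - C‖} ⊆
      {ω | ε / 2 ≤ ‖(n : ℝ)⁻¹ • ∑ t ∈ Finset.Icc 1 n, d t ω‖} ∪
      {ω | ε / 2 ≤ ‖(n : ℝ)⁻¹ • ∑ t ∈ Finset.Icc 1 n, D t ω‖} := by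
    intro ω hω
    have hω : ε < ‖(n : ℝ)⁻¹ • ∑ t ∈ Finset.Icc 1 n, y t ω - C‖ := hω
    have e : (n : ℝ)⁻¹ • ∑ t ∈ Finset.Icc 1 n, y t ω - C =
        (n : ℝ)⁻¹ • ∑ t ∈ Finset.Icc 1 n, d t ω + (n : ℝ)⁻¹ • ∑ t ∈ Finset.Icc 1 n, D t ω := by
      rw [← smul_add, ← Finset.sum_add_distrib]
      simp only [d, D, sub_add_sub_cancel]
      rw [Finset.sum_sub_distrib, Finset.sum_const, Nat.card_Icc, Nat.add_sub_cancel, smul_sub,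
        ← Nat.cast_smul_eq_nsmul ℝ, smul_smul, inv_mul_cancel₀ hn.ne', one_smul]
    rw [e] at hω
    by_contra hcon
    simp only [Set.mem_union, not_or] at hcon
    have h1 : ¬ ε / 2 ≤ ‖(n : ℝ)⁻¹ • ∑ t ∈ Finset.Icc 1 n, d t ω‖ := hcon.1
    have h2 : ¬ ε / 2 ≤ ‖(n : ℝ)⁻¹ • ∑ t ∈ Finset.Icc 1 n, D t ω‖ := hcon.2
    have h3 := norm_add_le ((n : ℝ)⁻¹ • ∑ t ∈ Finset.Icc 1 n, d t ω)
      ((n : ℝ)⁻¹ • ∑ t ∈ Finset.Icc 1 n, D t ω)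
    push Not at h1 h2
    linarith
  refine (measureReal_mono hset).trans ((measureReal_union_le _ _).trans (add_le_add ?_ hbias))
  refine hmart.trans (le_of_eq ?_)
  congr 3
  field_simp
  ring

end ConditionalBias

/-! ### Empirical autocovariance operators -/

section Autocovariance

variable {Ω : Type*} [m0 : MeasurableSpace Ω] {μ : Measure Ω} [IsProbabilityMeasure μ]
  {E : Type*} [MeasurableSpace E] {X : ℤ → Ω → E}

theorem IsStationarySeq.integral_comp_shift {G : Type*} [NormedAddCommGroup G] [NormedSpace ℝ G]
    (h : IsStationarySeq μ X) (hX : ∀ t, Measurable (X t)) {f : (ℤ → E) → G}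
    (hf : StronglyMeasurable f) (s : ℕ) :
    ∫ ω, f (fun t => X (t + s) ω) ∂μ = ∫ ω, f (fun t => X t ω) ∂μ := by
  rw [← integral_map (φ := fun ω t => X (t + s) ω)
      (measurable_pi_lambda _ fun t => hX (t + s)).aemeasurable hf.aestronglyMeasurable,
    ← h.map_shift hX s,
    integral_map (measurable_pi_lambda _ hX).aemeasurable hf.aestronglyMeasurable]

theorem norm_featureMap_sq {E : Type*} {H : Type*} [NormedAddCommGroup H] [InnerProductSpace ℝ H]
    [CompleteSpace H] [RKHS ℝ H E ℝ] (x : E) : ‖featureMap H x‖ ^ 2 = rkhsKernel H x x := by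
  rw [featureMap, rkhsKernel, ← real_inner_self_eq_norm_sq, ← RKHS.kernel_inner]
  simp

variable {H : Type*} [NormedAddCommGroup H] [InnerProductSpace ℝ H] [CompleteSpace H]
  [RKHS ℝ H E ℝ] [TopologicalSpace.SeparableSpace H] [MeasurableSpace H] [BorelSpace H]

theorem stronglyMeasurable_featureMap (hφ : Measurable (featureMap H : E → H)) {Ω : Type*}
    {m : MeasurableSpace Ω} {Y : Ω → E} (hY : Measurable[m] Y) :
    StronglyMeasurable[m] fun ω => featureMap H (Y ω) := by
  have : SecondCountableTopology H := UniformSpace.secondCountable_of_separable H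
  exact (hφ.comp hY).stronglyMeasurable

theorem integral_featureMap_eq_zero (hφ : Measurable (featureMap H : E → H))
    (hX : ∀ t, Measurable (X t)) (hstat : IsStationarySeq μ X)
    (hcent : meanEmbedding H μ (X 0) = 0) (t : ℕ) : ∫ ω, featureMap H (X t ω) ∂μ = 0 := by
  have h := hstat.integral_comp_shift hX
    (stronglyMeasurable_featureMap hφ (measurable_pi_apply (0 : ℤ))) t
  simp only [zero_add] at h
  exact h.trans hcent

theorem integral_hsTensor_featureMap (hφ : Measurable (featureMap H : E → H))
    (hX : ∀ t, Measurable (X t)) (hstat : IsStationarySeq μ X)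
    (hcent : meanEmbedding H μ (X 0) = 0) (η t : ℕ) :
    ∫ ω, hsTensor (featureMap H (X ((t : ℤ) + η) ω)) (featureMap H (X (t : ℤ) ω)) ∂μ =
      autocov H μ X η := by
  have h := hstat.integral_comp_shift hX (stronglyMeasurable_hsTensor
    (stronglyMeasurable_featureMap (H := H) hφ (measurable_pi_apply (η : ℤ)))
    (stronglyMeasurable_featureMap (H := H) hφ (measurable_pi_apply (0 : ℤ)))) t
  have hη : meanEmbedding H μ (X η) = 0 := integral_featureMap_eq_zero hφ hX hstat hcent η
  simp only [zero_add, add_comm (η : ℤ)] at h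
  rw [h, autocov, crossCov, hη, hcent]
  simp only [sub_zero]

/-- The bias of the tensors given the past up to time `a + η`, when the gap `t - a` is large enough
for the two factors to be either both separated from that past by `M`, or one separated from it and
one contained in it. In the second case the mean of the separated factor vanishes. -/
theorem integral_norm_condExp_hsTensor_sub_le (hφ : Measurable (featureMap H : E → H))
    (hX : ∀ t, Measurable (X t)) (hstat : IsStationarySeq μ X)
    (hcent : meanEmbedding H μ (X 0) = 0) {c : ℝ} (hc : 0 ≤ c)
    (hφc : ∀ x, ‖featureMap H x‖ ≤ √c) {η t : ℕ} {M a : ℤ}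
    (ha : a + η + M ≤ t ∨ (t ≤ a + η ∧ a + M ≤ t)) :
    ∫ ω, ‖(μ[fun ω => hsTensor (featureMap H (X ((t : ℤ) + η) ω)) (featureMap H (X (t : ℤ) ω)) |
      sigmaField X (Set.Iic (a + η))]) ω - autocov H μ X η‖ ∂μ ≤ 64 * alphaMix μ X M * c := by
  set y : Ω → HSOp H := fun ω =>
    hsTensor (featureMap H (X ((t : ℤ) + η) ω)) (featureMap H (X (t : ℤ) ω)) with hy
  have hcc : √c * √c = c := Real.mul_self_sqrt hc
  have hyc : ∀ ω, ‖y ω‖ ≤ c := fun ω => by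
    rw [hy, norm_hsTensor, ← hcc]
    exact mul_le_mul (hφc _) (hφc _) (norm_nonneg _) (Real.sqrt_nonneg _)
  have hym : ∀ {m : MeasurableSpace Ω}, Measurable[m] (X ((t : ℤ) + η)) →
      Measurable[m] (X (t : ℤ)) → StronglyMeasurable[m] y := fun h1 h2 =>
    stronglyMeasurable_hsTensor (stronglyMeasurable_featureMap hφ h1)
      (stronglyMeasurable_featureMap hφ h2)
  have hyi : Integrable y μ :=
    Integrable.of_bound (hym (hX _) (hX _)).aestronglyMeasurable c (ae_of_all _ hyc)
  have hα : 0 ≤ alphaMix μ X M := alphaCoeff_nonneg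
  have hC : ∫ ω, y ω ∂μ = autocov H μ X η := integral_hsTensor_featureMap hφ hX hstat hcent η t
  have hle := sigmaField_le hX
  refine integral_norm_condExp_sub_le (hle _) hyi fun g hg hg1 => ?_
  rcases ha with ha | ⟨hta, ha⟩
  · have h := integral_inner_sub_le_alphaCoeff (μ := μ) (hle _) (hle (Set.Ici (t : ℤ))) hg hg1
      (hym (measurable_sigmaField (Set.mem_Ici.2 (by omega)))
        (measurable_sigmaField (Set.mem_Ici.2 le_rfl))) hyc
    rw [hC, one_mul] at h
    have h2 := hstat.alphaCoeff_le_alphaMix hX ha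
    nlinarith
  · have key : ∀ g : Ω → HSOp H, StronglyMeasurable[sigmaField X (Set.Iic (a + η))] g →
        (∀ ω, ‖g ω‖ ≤ 1) → ∫ ω, inner ℝ (g ω) (y ω) ∂μ ≤ 32 * alphaMix μ X M * c := by
      intro g hg hg1
      have hgφ := stronglyMeasurable_toCLM_apply hg (stronglyMeasurable_featureMap (H := H) hφ
        (measurable_sigmaField (X := X) (Set.mem_Iic.2 hta)))
      have h := integral_inner_sub_le_alphaCoeff (μ := μ) (hle _) (hle (Set.Ici ((t : ℤ) + η)))
        (a := √c) hgφ (fun ω => by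
          refine (norm_toCLM_apply_le _ _).trans ?_
          exact (mul_le_of_le_one_left (norm_nonneg _) (hg1 ω)).trans (hφc _))
        (stronglyMeasurable_featureMap (H := H) hφ (measurable_sigmaField (X := X)
          (Set.mem_Ici.2 le_rfl))) fun ω => hφc _
      have hz : ∫ ω, featureMap H (X ((t : ℤ) + η) ω) ∂μ = 0 := by
        have := integral_featureMap_eq_zero hφ hX hstat hcent (t + η)
        rwa [Nat.cast_add] at this
      rw [hz, inner_zero_right, sub_zero, hcc] at h
      simp only [hy, inner_hsTensor]
      refine h.trans ?_
      have := hstat.alphaCoeff_le_alphaMix hX (show a + η + M ≤ (t : ℤ) + η by omega)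
      gcongr
    have h1 := key g hg hg1
    -- the mean `C` is itself estimated by testing against a constant direction
    have h2 := key (fun _ => -∫ ω, g ω ∂μ) stronglyMeasurable_const fun _ => by
      rw [norm_neg]
      refine (norm_integral_le_of_norm_le_const (ae_of_all μ hg1)).trans ?_
      simp
    rw [integral_inner hyi, hC, inner_neg_left] at h2
    linarith

end Autocovariance

/-- Comparison of the bias term with the mixing term, in the regime where the exponential term is
below `1`. -/
theorem mul_div_le_of_four_lt_exp {c ε w q : ℝ} (hc : 0 < c) (hε : 0 < ε) (hq : 1 ≤ q)
    (hw : w ≤ ε ^ 2 * q / (32 * c ^ 2)) (h : 4 < Real.exp w) : 128 * c / ε ≤ 22 * q := by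
  have hw4 : 1.38 < w := by
    have h1 : Real.log 4 < w := (Real.log_lt_iff_lt_exp (by norm_num)).2 h
    have h2 : Real.log 4 = 2 * Real.log 2 := by
      rw [← Real.log_rpow (by norm_num)]; norm_num
    have := Real.log_two_gt_d9
    linarith
  have h3 : 1.38 * (32 * c ^ 2) ≤ ε ^ 2 * q := by
    rw [← le_div_iff₀ (by positivity)]
    linarith
  rw [div_le_iff₀ hε]
  have h4 : 44 * c ^ 2 ≤ ε ^ 2 * q := by nlinarith [sq_nonneg c]
  -- one half of `22 q ε ^ 2` is at least `484 c ^ 2`, the other at least `11 ε ^ 2`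
  have h5 : 128 * c * ε ≤ 22 * q * ε * ε := by
    nlinarith [sq_nonneg (6 * c - ε), mul_le_mul_of_nonneg_left hq (sq_nonneg ε)]
  nlinarith

theorem mainTheorem5
    {Ω : Type*} [MeasurableSpace Ω] (μ : Measure Ω) [IsProbabilityMeasure μ]
    {E : Type*} [TopologicalSpace E] [PolishSpace E] [MeasurableSpace E] [BorelSpace E]
    {H : Type*} [NormedAddCommGroup H] [InnerProductSpace ℝ H] [CompleteSpace H]
    [RKHS ℝ H E ℝ] [TopologicalSpace.SeparableSpace H] [MeasurableSpace H] [BorelSpace H]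
    (hφ : Measurable (featureMap H : E → H))
    (X : ℤ → Ω → E) (hX : ∀ t, Measurable (X t))
    (hstat : IsStationarySeq μ X) (hmix : IsAlphaMixing μ X)
    (hcent : meanEmbedding H μ (X 0) = 0)
    (c : ℝ) (hc : IsLUB (Set.range fun x : E => rkhsKernel H x x) c) (η : ℕ) :
    Summable (eigenvalueSeq (covOfTensor H μ X η)) ∧
    ∀ (ε : ℝ) (ν n q : ℕ) (δ : ℝ), 0 < ε → 1 ≤ ν → 2 ≤ n → 1 ≤ q → q ≤ n / 2 →
      0 < δ → δ < 1 →
      μ.real {ω | ε < ‖empAutocov H X η n ω - autocov H μ X η‖} ≤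
        4 * ν * Real.exp (-((1 - δ) * ε ^ 2 * q / (32 * ν * c ^ 2)))
        + 22 * ν * q * Real.sqrt (1 + 8 * c / (ε * Real.sqrt (1 - δ)))
          * alphaMix μ X ((n / (2 * q) : ℕ) : ℤ)
        + 1 / (δ * ε ^ 2) * ∑' j : ℕ, eigenvalueSeq (covOfTensor H μ X η) (ν + j) := by
  have hker : ∀ x : E, ‖featureMap H x‖ ^ 2 ≤ c := fun x => by
    rw [norm_featureMap_sq]; exact hc.1 ⟨x, rfl⟩
  have hφc : ∀ x : E, ‖featureMap H x‖ ≤ √c := fun x => Real.le_sqrt_of_sq_le (hker x)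
  have hc0 : 0 ≤ c := by
    obtain ⟨ω⟩ := nonempty_of_isProbabilityMeasure μ
    exact (sq_nonneg _).trans (hker (X 0 ω))
  have hten : ∀ s t ω, ‖hsTensor (featureMap H (X s ω)) (featureMap H (X t ω))‖ ≤ c := by
    intro s t ω
    rw [norm_hsTensor, ← Real.mul_self_sqrt hc0]
    exact mul_le_mul (hφc _) (hφc _) (norm_nonneg _) (Real.sqrt_nonneg _)
  have hmeas : ∀ {m : MeasurableSpace Ω} {s t : ℤ}, Measurable[m] (X s) → Measurable[m] (X t) →
      StronglyMeasurable[m] fun ω => hsTensor (featureMap H (X s ω)) (featureMap H (X t ω)) :=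
    fun h1 h2 => stronglyMeasurable_hsTensor (stronglyMeasurable_featureMap hφ h1)
      (stronglyMeasurable_featureMap hφ h2)
  refine ⟨summable_eigenvalueSeq_integral_rankOne (a := c + ‖autocov H μ X η‖)
    ((hmeas (hX _) (hX _)).sub stronglyMeasurable_const) fun ω =>
      (norm_sub_le _ _).trans (add_le_add_left (hten _ _ ω) _), ?_⟩
  intro ε ν n q δ hε hν hn hq hqn hδ hδ1
  have hα : ∀ M, 0 ≤ alphaMix μ X M := fun M => alphaCoeff_nonneg
  have htail : 0 ≤ 1 / (δ * ε ^ 2) * ∑' j : ℕ, eigenvalueSeq (covOfTensor H μ X η) (ν + j) :=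
    mul_nonneg (by positivity) (tsum_nonneg fun j => eigenvalueSeq_nonneg _ _)
  have hν' : (1 : ℝ) ≤ ν := by exact_mod_cast hν
  have hq' : (1 : ℝ) ≤ q := by exact_mod_cast hq
  have hδ' : 0 < 1 - δ := sub_pos.2 hδ1
  set M : ℕ := n / (2 * q) with hM
  set z : ℝ := (1 - δ) * ε ^ 2 * q / (32 * ν * c ^ 2) with hz
  have hroot : 1 ≤ √(1 + 8 * c / (ε * √(1 - δ))) := Real.one_le_sqrt.2 (by
    have : 0 ≤ 8 * c / (ε * √(1 - δ)) := by positivity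
    linarith)
  have hmixterm : 22 * q * alphaMix μ X M ≤
      22 * ν * q * √(1 + 8 * c / (ε * √(1 - δ))) * alphaMix μ X M := by
    have h1 : (1 : ℝ) * 1 ≤ ν * √(1 + 8 * c / (ε * √(1 - δ))) := by gcongr
    have h2 : 0 ≤ 22 * q * alphaMix μ X M := mul_nonneg (by positivity) (hα _)
    nlinarith
  have hmix0 : 0 ≤ 22 * q * alphaMix μ X M := mul_nonneg (by positivity) (hα _)
  by_cases htriv : 1 ≤ 4 * ν * Real.exp (-z)
  · linarith [measureReal_le_one (μ := μ)
      (s := {ω | ε < ‖empAutocov H X η n ω - autocov H μ X η‖})]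
  push Not at htriv
  have hcpos : 0 < c := by
    refine hc0.lt_of_ne fun h => ?_
    rw [hz, ← h] at htriv
    norm_num at htriv
    linarith
  have h4z : 4 < Real.exp z := by
    have h1 : 4 * Real.exp (-z) < 1 := by
      have := Real.exp_pos (-z)
      nlinarith
    rw [Real.exp_neg] at h1
    rwa [← div_eq_mul_inv, div_lt_one (Real.exp_pos z)] at h1
  have hzw : z ≤ ε ^ 2 * q / (32 * c ^ 2) := by
    rw [hz, div_le_div_iff₀ (by positivity) (by positivity)]
    have h1 : 1 - δ ≤ ν := by linarith
    have h2 : 0 ≤ ε ^ 2 * q * (32 * c ^ 2) := by positivity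
    nlinarith
  -- For lags up to `M` both factors are kept `M` steps away from the past, which takes a gap `2 M`;
  -- for larger lags a gap `M` suffices, the older factor then being part of the past.
  obtain ⟨L, hL, hLq, hgap⟩ : ∃ L : ℕ, 0 < L ∧ L * q ≤ n ∧ ∀ t : ℤ,
      t - L + η + M ≤ t ∨ (t ≤ t - L + η ∧ t - L + M ≤ t) := by
    have hM0 : 0 < M := Nat.div_pos (by omega) (by omega)
    have hMq : M * (2 * q) ≤ n := Nat.div_mul_le_self n (2 * q)
    rcases le_total η M with h | h
    · exact ⟨2 * M, by omega, by linarith, fun t => Or.inl (by push_cast; omega)⟩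
    · exact ⟨M, hM0, by nlinarith, fun t => Or.inr ⟨by omega, by omega⟩⟩
  have hqL : q ≤ n / L := (Nat.le_div_iff_mul_le hL).2 (by linarith)
  have hLn : L ≤ n := (Nat.le_mul_of_pos_right L (by omega)).trans hLq
  have hbound := measureReal_lt_norm_average_sub_le (μ := μ) hL hLn
    (fun t ω => hsTensor (featureMap H (X ((t : ℤ) + η) ω)) (featureMap H (X (t : ℤ) ω)))
    (autocov H μ X η) (fun t : ℕ => sigmaField X (Set.Iic ((t : ℤ) - L + η)))
    (fun t => sigmaField_le hX _) hcpos (fun t => hmeas (hX _) (hX _)) (fun t => hten _ _)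
    (fun s t hst => hmeas (measurable_sigmaField (Set.mem_Iic.2 (by omega)))
      (measurable_sigmaField (Set.mem_Iic.2 (by omega))))
    (fun s t hst => sigmaField_mono (Set.Iic_subset_Iic.2 (by omega)))
    (fun t => integral_norm_condExp_hsTensor_sub_le hφ hX hstat hcent hc0 hφc (hgap t)) hε
  refine hbound.trans ?_
  have hexp : 2 * Real.exp (-(ε ^ 2 * (n / L : ℕ) / (32 * c ^ 2))) ≤ 4 * ν * Real.exp (-z) := by
    have h1 : z ≤ ε ^ 2 * (n / L : ℕ) / (32 * c ^ 2) := hzw.trans (by gcongr)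
    have h2 := Real.exp_le_exp.2 (neg_le_neg h1)
    have h3 := Real.exp_pos (-z)
    nlinarith
  have hbias : 2 * (64 * alphaMix μ X M * c) / ε ≤ 22 * q * alphaMix μ X M := by
    have h1 := mul_le_mul_of_nonneg_right (mul_div_le_of_four_lt_exp hcpos hε hq' hzw h4z) (hα M)
    calc _ = 128 * c / ε * alphaMix μ X M := by ring
      _ ≤ _ := h1
  linarith
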